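/- For every sequence $D=\{D_n\}_{n\in\mathbb N}$ of probability distributions, $D_n$ on $\{0,1\}^n$, the class $\mathsf{BPP/samp}(D)$ is a proper subset of $\mathsf{P/poly}$. Here $\mathsf{P/poly}$ is the class of languages $L\subseteq\{0,1\}^*$ for which there are a deterministic Turing machine $M$ running in polynomial time and a sequence of advice strings $\{a_n\}_{n\in\mathbb N}$ of polynomially bounded length such that $M(x,a_{|x|})=\mathbb 1\{x\in L\}$ for every binary string $x$. The class $\mathsf{BPP/samp}(D)$ consists of the languages $L\subseteq\{0,1\}^*$ for which there are a probabilistic Turing machine $M$ running in polynomial time and a polynomial $p$ such that for every binary string $x$, with $n=|x|$, $$\mathbb P\big(M(x,\mathcal T_{p(n)})=\mathbb 1\{x\in L\}\big)\ \ge\ \tfrac23,\qquad \mathcal T_{p(n)}=\big\{(x_i,\mathbb 1\{x_i\in L\})\big\}_{i=1}^{p(n)},$$ where $x_1,\dots,x_{p(n)}$ are independent with distribution $D_n$, and the probability is over both the training set $\mathcal T_{p(n)}$ and the internal randomness of $M$. -/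

import Mathlib

open scoped ENNReal

/-- `P/poly`: the languages `L` for which there are a function `f` (the decision of a deterministic
Turing machine on the pair input / advice) that is computable in polynomial time, in the sense of
Mathlib's `Turing.TM2ComputableInPolyTime`, and a sequence of advice strings `a n` of polynomially
bounded length, with `f (x, a |x|) = 1` if `x ∈ L` and `= 0` otherwise.

The pair `(x, a)` is given to the machine as `x # a`, over the alphabet `{0, 1, #} = Option Bool`.
`Turing.FinTM2` only records that the input alphabet is finite; finiteness of the alphabets of all
the other stacks is required here explicitly. -/
def PPoly : Set (Language Bool) :=
  {L | ∃ (f : List Bool × List Bool → Bool)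
      (M : Turing.TM2ComputableInPolyTime
        (fun xa : List Bool × List Bool => xa.1.map some ++ none :: xa.2.map some)
        (fun b : Bool => [b]) f)
      (a : ℕ → List Bool) (q : Polynomial ℕ),
      (∀ k, Finite (M.tm.Γ k)) ∧
      (∀ n, (a n).length ≤ q.eval n) ∧
      ∀ x : List Bool, f (x, a x.length) = true ↔ x ∈ L}

/-- A probabilistic Turing machine with input alphabet `{0, 1, #} = Option Bool` and output alphabet
`{0, 1}`: a (multi-stack) Turing machine with two transition functions `m` and `m'`. At each step a
fair coin decides which of the two is applied. -/
structure ProbTM extends Turing.FinTM2 where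
  /-- all stack alphabets are finite -/
  alphabetFinite : ∀ k, Finite (Γ k)
  /-- the second transition function -/
  m' : Λ → Turing.TM2.Stmt Γ Λ σ
  /-- the symbols of the input stack are `0`, `1` and `#` -/
  inputAlphabet : Γ k₀ ≃ Option Bool
  /-- the symbols of the output stack are `0` and `1` -/
  outputAlphabet : Γ k₁ ≃ Bool

namespace ProbTM

/-- One computation step with coin `c`; `none` if the machine has halted. -/
def step (M : ProbTM) (c : Bool) : M.Cfg → Option M.Cfg :=
  Turing.TM2.step (fun l => if c then M.m' l else M.m l)

/-- The configuration reached with the successive coins of a list. A halted machine stays in its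
configuration. -/
def run (M : ProbTM) : List Bool → M.Cfg → M.Cfg
  | [], C => C
  | c :: cs, C => M.run cs ((M.step c C).getD C)

/-- On input `s` and with coins `cs` the machine has halted with output `b`. -/
def Outputs (M : ProbTM) (s : List (Option Bool)) (cs : List Bool) (b : Bool) : Prop :=
  M.run cs (Turing.initList M.toFinTM2 (s.map M.inputAlphabet.symm)) =
    Turing.haltList M.toFinTM2 [M.outputAlphabet.symm b]

/-- On every input `s`, and for all outcomes of its coins, the machine halts within `t |s|` steps
and outputs a bit. -/
def RunsInTime (M : ProbTM) (t : ℕ → ℕ) : Prop :=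
  ∀ (s : List (Option Bool)) (cs : List Bool), cs.length = t s.length → ∃ b, M.Outputs s cs b

/-- The probability, over `t` independent fair coins, that on input `s` the machine has halted with
output `b` (within `t` steps). -/
noncomputable def outputProb (M : ProbTM) (t : ℕ) (s : List (Option Bool)) (b : Bool) : ℝ≥0∞ :=
  (Nat.card {cs : Fin t → Bool // M.Outputs s (List.ofFn cs) b} : ℝ≥0∞) / 2 ^ t

end ProbTM

/-- The word `x # y₁ b₁ # y₂ b₂ # … # y_p b_p` that presents an input `x` and a training set
`(y₁, b₁), …, (y_p, b_p)` to a machine. -/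
def encodeTraining (x : List Bool) (T : List (List Bool × Bool)) : List (Option Bool) :=
  x.map some ++ T.flatMap (fun yb => none :: (yb.1.map some ++ [some yb.2]))

open Classical in
/-- The training set for the language `L` at the points `y₁, …, y_p ∈ {0, 1}ⁿ`: each point is
labelled by whether it belongs to `L`. -/
noncomputable def trainingSet (L : Language Bool) {n p : ℕ} (y : Fin p → (Fin n → Bool)) :
    List (List Bool × Bool) :=
  List.ofFn (fun i => (List.ofFn (y i), decide (List.ofFn (y i) ∈ L)))

open Classical in
/-- The probability that `M` (run for `t |s|` steps on its input `s`) decides correctly whether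
`x ∈ L`, when it is given `x` and a training set for `L` at `p` independent points with
distribution `μ` on `{0, 1}ⁿ`. The probability is over the points and the coins of `M`. -/
noncomputable def successProb (M : ProbTM) (t : ℕ → ℕ) {n : ℕ} (μ : PMF (Fin n → Bool)) (p : ℕ)
    (L : Language Bool) (x : List Bool) : ℝ≥0∞ :=
  ∑ y : Fin p → (Fin n → Bool), (∏ i, μ (y i)) *
    M.outputProb (t (encodeTraining x (trainingSet L y)).length)
      (encodeTraining x (trainingSet L y)) (decide (x ∈ L))

/-- `BPP/samp(D)`: the languages `L` for which there are a probabilistic Turing machine running in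
polynomial time and a polynomial `p` such that for every `x`, given `x` and a training set for `L`
at `p |x|` independent points with distribution `D |x|`, the machine decides with probability at
least `2 / 3` correctly whether `x ∈ L`. -/
def BPPSamp (D : (n : ℕ) → PMF (Fin n → Bool)) : Set (Language Bool) :=
  {L | ∃ (M : ProbTM) (t p : Polynomial ℕ), M.RunsInTime (fun n => t.eval n) ∧
      ∀ x : List Bool,
        2 / 3 ≤ successProb M (fun n => t.eval n) (D x.length) (p.eval x.length) L x}

/-! The inclusion is Adleman's argument. A trial is a choice of sample points and coins. Its law
depends only on the length `n`, and the labels of the points depend only on `L`, so the same trials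
can be reused for all words of length `n`. Give each word a weight, multiplied by `2/3` at a trial
that decides it correctly and by `3/2` otherwise. A random trial shrinks the expected total weight
by `17/18`, so trials can be chosen one by one until the total is below `1`; then every word is
decided correctly by the majority (`exists_list_majority`). These `13 (n + 1)` trials, labels
included, are the advice. A simulating machine replays them and takes the majority; it must halt in
polynomial time on every advice string (`AdviceSimulation.exists_within_halt`) and be correct on the
intended one (`AdviceSimulation.exists_within_majority`).

For properness, choose `z n` of mass at most `2⁻ⁿ`. A polynomial sample contains it with negligible
probability, so with high probability the training set does not reveal whether `z n` is in the
language (`successProb_lt_of_insert`). Up to renaming there are countably many machines, and `L` is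
built by diagonalization: `z n` is put in exactly when the machine assigned to length `n` would
succeed on it for the empty language. Having at most one word of each length, `L` is in `P/poly`:
the advice is that word. -/

namespace Turing.FinTM2

/-! ### Reachability in bounded time -/

variable {tm : FinTM2}

/-- `tm` goes from configuration `a` to `b` in at most `n` steps. -/
def Within (tm : FinTM2) (n : ℕ) (a b : tm.Cfg) : Prop :=
  ∃ m ≤ n, (flip bind tm.step)^[m] (some a) = some b

theorem Within.refl (n : ℕ) (a : tm.Cfg) : tm.Within n a a := ⟨0, Nat.zero_le _, rfl⟩

theorem Within.trans {m n : ℕ} {a b c : tm.Cfg} (h₁ : tm.Within m a b) (h₂ : tm.Within n b c) :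
    tm.Within (m + n) a c := by
  obtain ⟨i, hi, h₁⟩ := h₁
  obtain ⟨j, hj, h₂⟩ := h₂
  exact ⟨j + i, by omega, by rw [Function.iterate_add_apply, h₁, h₂]⟩

theorem Within.mono {m n : ℕ} {a b : tm.Cfg} (h : tm.Within m a b) (hmn : m ≤ n) :
    tm.Within n a b := by
  obtain ⟨i, hi, h⟩ := h
  exact ⟨i, hi.trans hmn, h⟩

theorem Within.single {a b : tm.Cfg} (h : tm.step a = some b) : tm.Within 1 a b :=
  ⟨1, le_rfl, h⟩

theorem Within.head {n : ℕ} {a b c : tm.Cfg} (h : tm.step a = some b) (h₂ : tm.Within n b c) :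
    tm.Within (n + 1) a c :=
  ((Within.single h).trans h₂).mono (by omega)

theorem iterate_step_none (n : ℕ) : (flip bind tm.step)^[n] none = none :=
  Function.iterate_fixed rfl n

/-- A machine cannot reach two different configurations in which it has halted. -/
theorem Within.unique {m n : ℕ} {a b c : tm.Cfg} (h₁ : tm.Within m a b) (h₂ : tm.Within n a c)
    (hb : tm.step b = none) (hc : tm.step c = none) : b = c := by
  obtain ⟨i, -, h₁⟩ := h₁
  obtain ⟨j, -, h₂⟩ := h₂
  have key : ∀ (i j : ℕ) (b c : tm.Cfg), tm.step b = none → i < j →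
      (flip bind tm.step)^[i] (some a) = some b → (flip bind tm.step)^[j] (some a) ≠ some c := by
    intro i j b c hb hij h₁ h₂
    obtain ⟨d, rfl⟩ := Nat.exists_eq_add_of_lt hij
    rw [show i + d + 1 = d + 1 + i by omega, Function.iterate_add_apply, h₁,
      Function.iterate_succ_apply] at h₂
    have : flip bind tm.step (some b) = none := hb
    rw [this, iterate_step_none] at h₂
    cases h₂
  rcases lt_trichotomy i j with h | rfl | h
  · exact absurd h₂ (key i j b c hb h h₁)
  · exact Option.some.inj (h₁.symm.trans h₂)
  · exact absurd h₁ (key j i c b hc h h₂)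

theorem initList_eq (tm : FinTM2) (s : List (tm.Γ tm.k₀)) :
    initList tm s = ⟨some tm.main, tm.initialState, Function.update (fun _ => []) tm.k₀ s⟩ := by
  unfold initList
  congr 1
  funext k
  by_cases h : k = tm.k₀
  · subst h; simp
  · simp [h]

theorem haltList_eq (tm : FinTM2) (s : List (tm.Γ tm.k₁)) :
    haltList tm s = ⟨none, tm.initialState, Function.update (fun _ => []) tm.k₁ s⟩ := by
  unfold haltList
  congr 1
  funext k
  by_cases h : k = tm.k₁
  · subst h; simp
  · simp [h]

theorem step_haltList (tm : FinTM2) (s : List (tm.Γ tm.k₁)) :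
    tm.step (haltList tm s) = none := by
  rw [haltList_eq]; rfl

theorem haltList_injective (tm : FinTM2) : Function.Injective (haltList tm) := by
  intro s s' h
  rw [haltList_eq, haltList_eq] at h
  have := congrArg (fun c : TM2.Cfg tm.Γ tm.Λ tm.σ => c.stk tm.k₁) h
  simpa using this

theorem Within.congr_right {n : ℕ} {a b c : tm.Cfg}
    (h : tm.Within n a b) (hbc : b = c) : tm.Within n a c := hbc ▸ h

theorem Within.congr_left {n : ℕ} {a b c : tm.Cfg}
    (h : tm.Within n a b) (hac : a = c) : tm.Within n c b := hac ▸ h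

end Turing.FinTM2

open Turing Turing.FinTM2 in
/-- A machine that on every pair halts with one output bit in polynomial time witnesses that a
language with suitable advice is in `P/poly`. -/
theorem mem_PPoly_of_within {L : Language Bool} (tm : FinTM2) (hΓ : ∀ k, Finite (tm.Γ k))
    (ein : tm.Γ tm.k₀ ≃ Option Bool) (eout : tm.Γ tm.k₁ ≃ Bool) (time : Polynomial ℕ)
    (htot : ∀ x a : List Bool, ∃ b, tm.Within (time.eval (x.length + 1 + a.length))
      (initList tm ((x.map some ++ none :: a.map some).map ein.symm)) (haltList tm [eout.symm b]))
    (a : ℕ → List Bool) (q : Polynomial ℕ) (hq : ∀ n, (a n).length ≤ q.eval n)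
    (hL : ∀ x : List Bool, ∃ b n, (b = true ↔ x ∈ L) ∧ tm.Within n
      (initList tm ((x.map some ++ none :: (a x.length).map some).map ein.symm))
      (haltList tm [eout.symm b])) : L ∈ PPoly := by
  choose f hf using htot
  have hf' : ∀ xa : List Bool × List Bool, ∃ m, m ≤ time.eval (xa.1.length + 1 + xa.2.length) ∧ _ :=
    fun xa => hf xa.1 xa.2
  choose m hm hm' using hf'
  refine ⟨fun xa => f xa.1 xa.2,
    { tm := tm, inputAlphabet := ein, outputAlphabet := eout, time := time,
      outputsFun := fun xa => ⟨⟨m xa, hm' xa⟩, (hm xa).trans (le_of_eq ?_)⟩ }, a, q, hΓ, hq, ?_⟩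
  · simp [add_assoc, add_comm 1]
  · intro x
    obtain ⟨b, n, hb, h⟩ := hL x
    -- Halting configurations are unique, so the bit found within the time bound is the one in `hL`,
    -- whose own number of steps is immaterial.
    have := haltList_injective tm ((hf x (a x.length)).unique h (step_haltList _ _)
      (step_haltList _ _))
    simp only [List.cons.injEq, EmbeddingLike.apply_eq_iff_eq, and_true] at this
    rw [← hb, ← this]

/-! ### A machine comparing a word with its advice -/

namespace ReverseTest
open Turing Turing.TM2.Stmt

/-- The alphabet of the input stack `false` and of the working stack `true`. -/
def Γ (k : Bool) : Type := cond k Bool (Option Bool)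

/-- The internal state: whether all comparisons succeeded so far, and the two symbols read last. -/
abbrev State := Bool × Option Bool × Option Bool

/-- A word `x # a` is accepted if `a` is the reverse of `x`: first `x` is moved to the second stack,
then the two stacks are compared. -/
def stmt : Bool → TM2.Stmt Γ Bool State
  | false =>
    pop false (fun v (a : Option (Option Bool)) => (v.1, a.join, none)) <|
    branch (fun v => v.2.1.isSome)
      (push true (fun v => (v.2.1.getD false : Bool)) <| load (fun v => (v.1, none, none)) <|
        goto fun _ => false)
      (goto fun _ => true)
  | true =>
    pop false (fun v (a : Option (Option Bool)) => (v.1, a.join, none)) <|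
    pop true (fun v (a : Option Bool) => (v.1, v.2.1, a)) <|
    branch (fun v => v.2.1.isNone && v.2.2.isNone)
      -- `haltList` demands the initial internal state, so the flag is reset once it is on the
      -- stack.
      (push true (fun v => (v.1 : Bool)) <| load (fun _ => (true, none, none)) halt)
      (load (fun v => (v.1 && v.2.1 == v.2.2, none, none)) <| goto fun _ => true)

instance (k : Bool) : Fintype (Γ k) :=
  match k with
  | true => inferInstanceAs (Fintype Bool)
  | false => inferInstanceAs (Fintype (Option Bool))

theorem finite_Γ (k : Bool) : Finite (Γ k) := Finite.of_fintype _

/-- The machine that recognizes the words `x # a` with `a` the reverse of `x`. -/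
def tm : FinTM2 where
  K := Bool
  k₀ := false
  k₁ := true
  Γ := Γ
  Λ := Bool
  main := false
  σ := State
  initialState := (true, none, none)
  m := stmt

/-- The two stacks as one function. -/
def stk (I : List (Option Bool)) (W : List Bool) : ∀ k, List (Γ k)
  | false => I
  | true => W

section
variable (q : TM2.Stmt Γ Bool State) (v : State) (I : List (Option Bool)) (W : List Bool)

theorem stepAux_pop_false (f : State → Option (Option Bool) → State) :
    TM2.stepAux (pop false f q) v (stk I W) = TM2.stepAux q (f v I.head?) (stk I.tail W) :=
  congrArg (TM2.stepAux q _) (funext fun k => by cases k <;> rfl)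

theorem stepAux_pop_true (f : State → Option Bool → State) :
    TM2.stepAux (pop true f q) v (stk I W) = TM2.stepAux q (f v W.head?) (stk I W.tail) :=
  congrArg (TM2.stepAux q _) (funext fun k => by cases k <;> rfl)

theorem stepAux_push_true (f : State → Bool) :
    TM2.stepAux (push true f q) v (stk I W) = TM2.stepAux q v (stk I (f v :: W)) :=
  congrArg (TM2.stepAux q _) (funext fun k => by cases k <;> rfl)

end

/-- A configuration between two steps. -/
def cfg (l : Option Bool) (f : Bool) (I : List (Option Bool)) (W : List Bool) : tm.Cfg :=
  ⟨l, (f, none, none), stk I W⟩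

theorem step_cfg (l : Bool) (f I W) : tm.step (cfg (some l) f I W) =
    some (TM2.stepAux (stmt l) (f, none, none) (stk I W)) := rfl

theorem initList_eq (s : List (Option Bool)) : initList tm s = cfg (some false) true s [] := by
  refine (FinTM2.initList_eq tm s).trans ?_
  exact congrArg (TM2.Cfg.mk _ _) (funext fun k => by cases k <;> rfl)

theorem haltList_eq (s : List Bool) : haltList tm s = cfg none true [] s := by
  refine (FinTM2.haltList_eq tm s).trans ?_
  exact congrArg (TM2.Cfg.mk _ _) (funext fun k => by cases k <;> rfl)

theorem step_read_some (f b I W) :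
    tm.step (cfg (some false) f (some b :: I) W) = some (cfg (some false) f I (b :: W)) := by
  rw [step_cfg]; simp [stmt, stepAux_pop_false, stepAux_push_true, cfg]; rfl

theorem step_read_none (f I W) :
    tm.step (cfg (some false) f (none :: I) W) = some (cfg (some true) f I W) := by
  rw [step_cfg]; simp [stmt, stepAux_pop_false, stepAux_push_true, cfg]; rfl

/-- An empty stack pops as `none` and stays empty, so words of different lengths are caught by a
`none` meeting a `some`. -/
theorem step_compare (f) (I W : List Bool) (h : ¬ (I = [] ∧ W = [])) :
    tm.step (cfg (some true) f (I.map some) W) =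
      some (cfg (some true) (f && I.head? == W.head?) (I.tail.map some) W.tail) := by
  cases I <;> cases W <;> simp at h <;> rw [step_cfg] <;>
  simp [stmt, stepAux_pop_false, stepAux_pop_true, stepAux_push_true, cfg] <;> rfl

theorem step_compare_nil (f) :
    tm.step (cfg (some true) f [] []) = some (cfg none true [] [f]) := by
  rw [step_cfg]; simp [stmt, stepAux_pop_false, stepAux_pop_true, stepAux_push_true, cfg]; rfl

theorem within_read (x : List Bool) (I W) :
    tm.Within (x.length + 1) (cfg (some false) true (x.map some ++ none :: I) W)
      (cfg (some true) true I (x.reverse ++ W)) := by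
  induction x generalizing W with
  | nil => exact .single (step_read_none ..)
  | cons b x ih => simpa using FinTM2.Within.head (step_read_some ..) (ih (b :: W))

theorem within_compare (I W : List Bool) (f) :
    tm.Within (I.length + W.length + 1) (cfg (some true) f (I.map some) W)
      (cfg none true [] [f && I == W]) := by
  induction hn : I.length + W.length using Nat.strong_induction_on generalizing I W f with
  | _ n ih =>
    by_cases h : I = [] ∧ W = []
    · obtain ⟨rfl, rfl⟩ := h
      exact (FinTM2.Within.single (by simpa using step_compare_nil f)).mono (by omega)
    · have hlt : I.tail.length + W.tail.length < n := by
        cases I <;> cases W <;> simp at h hn ⊢ <;> omega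
      have := (ih _ hlt I.tail W.tail (f && I.head? == W.head?) rfl)
      refine ((FinTM2.Within.head (step_compare f I W h) this).mono (by omega)).congr_right ?_
      refine congrArg (fun b => cfg none true [] [b]) ?_
      cases I <;> cases W <;> simp [Bool.and_assoc] at h ⊢

theorem within_halt (x a : List Bool) :
    tm.Within (2 * (x.length + 1 + a.length)) (initList tm (x.map some ++ none :: a.map some))
      (haltList tm [a == x.reverse]) := by
  refine initList_eq _ ▸ haltList_eq _ ▸ ?_
  have h₁ := within_read x (a.map some) []
  rw [List.append_nil] at h₁
  refine ((h₁.trans (within_compare a x.reverse true)).mono ?_).congr_right ?_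
  · simp; omega
  · exact congrArg (fun b => cfg none true [] [b]) (by simp)

end ReverseTest

open Turing in
/-- A language with at most one word of each length is in `P/poly`. -/
theorem mem_PPoly_of_subsingleton (L : Language Bool) (z : ℕ → List Bool)
    (hz : ∀ n, (z n).length = n) (c : ℕ → Prop)
    (hL : ∀ x : List Bool, x ∈ L ↔ c x.length ∧ x = z x.length) : L ∈ PPoly := by
  classical
  -- If no word of length `n` is in `L`, the advice has length `n + 1` and is the reverse of no word
  -- of length `n`.
  let a (n : ℕ) : List Bool := if c n then (z n).reverse else List.replicate (n + 1) false
  refine mem_PPoly_of_within ReverseTest.tm ReverseTest.finite_Γ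
    (Equiv.refl _) (Equiv.refl _) (2 * Polynomial.X) (fun x a => ⟨a == x.reverse, ?_⟩)
    a (Polynomial.X + 1) (fun n => ?_) (fun x => ⟨a x.length == x.reverse,
      2 * (x.length + 1 + (a x.length).length), ?_, ?_⟩)
  · exact ((ReverseTest.within_halt x a).congr_left
      (congrArg (initList ReverseTest.tm) (List.map_id _).symm)).mono (by simp)
  · simp only [a]; split_ifs <;> simp [hz]
  · rw [beq_iff_eq, hL]
    by_cases h : c x.length
    · simp [a, h, eq_comm]
    · simp only [a, h, if_false, false_and, iff_false]
      intro h'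
      simpa using congrArg List.length h'
  · exact (ReverseTest.within_halt x (a x.length)).congr_left
      (congrArg (initList ReverseTest.tm) (List.map_id _).symm)

/-! ### A deterministic machine replaying runs from advice -/

namespace AdviceSimulation
open Turing Turing.TM2.Stmt

/-- The stacks added to those of the simulated machine: the input, of which the advice remains after
the first phase, the reversed word, the output and the majority counter. -/
inductive AuxStack
  | inp | word | out | tally
  deriving DecidableEq

/-- The labels added to those of the simulated machine. -/
inductive AuxLabel
  | scan | next | fetch | copy | restore | done | skip | clearWord | sign
  | clearTally (b : Bool)
  deriving DecidableEq

instance : Fintype AuxStack :=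
  ⟨{.inp, .word, .out, .tally}, by rintro (_ | _ | _ | _) <;> decide⟩

instance : Fintype AuxLabel :=
  ⟨{.scan, .next, .fetch, .copy, .restore, .done, .skip, .clearWord, .sign, .clearTally false,
    .clearTally true}, by rintro (_ | _ | _ | _ | _ | _ | _ | _ | _ | _ | _) <;> decide⟩

/-- The alphabets of the added stacks. -/
def AuxStack.Γ : AuxStack → Type
  | inp => Option Bool
  | _ => Bool

instance (k : AuxStack) : Finite k.Γ := by
  cases k
  exacts [inferInstanceAs (Finite (Option Bool)), inferInstanceAs (Finite Bool),
    inferInstanceAs (Finite Bool), inferInstanceAs (Finite Bool)]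

open AuxStack AuxLabel

variable (M : ProbTM)

/-- The alphabets of all stacks. -/
def Γ : M.K ⊕ AuxStack → Type := Sum.elim M.Γ AuxStack.Γ

/-- The state of the simulated machine, and the two bits read last. -/
abbrev State := M.σ × Option Bool × Option Bool

/-- The labels of the simulated machine and the new ones. -/
abbrev Label := M.Λ ⊕ AuxLabel

variable {M}

/-- A statement of the simulated machine as a statement of the simulating one. -/
def embed : TM2.Stmt M.Γ M.Λ M.σ → TM2.Stmt (Γ M) (Label M) (State M)
  | push k f q => push (.inl k) (fun v => f v.1) (embed q)
  | peek k f q => peek (.inl k) (fun v (a : Option (M.Γ k)) => (f v.1 a, v.2)) (embed q)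
  | pop k f q => pop (.inl k) (fun v (a : Option (M.Γ k)) => (f v.1 a, v.2)) (embed q)
  | load f q => load (fun v => (f v.1, v.2)) (embed q)
  | branch f q₁ q₂ => branch (fun v => f v.1) (embed q₁) (embed q₂)
  | goto f => goto fun v => .inl (f v.1)
  | halt => goto fun _ => .inr done

/-- Forget the two bits read last. -/
def reset (q : TM2.Stmt (Γ M) (Label M) (State M)) : TM2.Stmt (Γ M) (Label M) (State M) :=
  load (fun v => (v.1, none, none)) q

/-- Forget the two bits read last and jump to a new label. -/
def jump (l : AuxLabel) : TM2.Stmt (Γ M) (Label M) (State M) := reset (goto fun _ => .inr l)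

/-- Pop a bit of the input; the separator counts as a missing bit. -/
def popInp₁ (q : TM2.Stmt (Γ M) (Label M) (State M)) : TM2.Stmt (Γ M) (Label M) (State M) :=
  pop (.inr inp) (fun v (a : Option (Option Bool)) => (v.1, a.join, v.2.2)) q

/-- Pop a bit of the input into the second register. -/
def popInp₂ (q : TM2.Stmt (Γ M) (Label M) (State M)) : TM2.Stmt (Γ M) (Label M) (State M) :=
  pop (.inr inp) (fun v (a : Option (Option Bool)) => (v.1, v.2.1, a.join)) q

/-- Pop a bit of the reversed word. -/
def popWord (q : TM2.Stmt (Γ M) (Label M) (State M)) : TM2.Stmt (Γ M) (Label M) (State M) :=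
  pop (.inr word) (fun v (a : Option Bool) => (v.1, a, v.2.2)) q

/-- The symbol `0`, `1` or `#` that is coded by two bits, if there is one. -/
def decode : Option Bool → Option Bool → Option (Option Bool)
  | some false, some c => some (some c)
  | some true, some false => some none
  | _, _ => none

variable (M) in
/-- The program. The word `x` is moved to its stack. As long as there is advice, a training set is
copied from the advice to the input stack of `M`, the word `x` is put on top of it, `M` is run with
coins taken from the advice until it halts, its output is tallied, and the unused coins are
skipped. At the end, the sign of the counter is the output. -/
def stmt : Label M → TM2.Stmt (Γ M) (Label M) (State M)
  -- A simulated step consumes a marker, which is ignored, and a coin; a missing coin counts as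
  -- `false`, so any advice drives the simulation.
  | .inl l => popInp₁ <| popInp₂ <|
      branch (fun v => v.2.2 == some true) (reset (embed (M.m' l))) (reset (embed (M.m l)))
  | .inr scan => popInp₁ <|
      branch (fun v => v.2.1.isSome)
        (push (.inr word) (fun v => (v.2.1.getD false : Bool)) (jump scan)) (jump next)
  | .inr next =>
      peek (.inr inp) (fun v (a : Option (Option Bool)) => (v.1, a.map fun _ => true, none)) <|
      branch (fun v => v.2.1.isSome) (jump fetch) (jump clearWord)
  -- The pair `11` codes no symbol and ends the training data; so does any malformed or missing
  -- pair.
  | .inr fetch => popInp₁ <| popInp₂ <|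
      branch (fun v => (decode v.2.1 v.2.2).isSome)
        (push (.inl M.k₀)
          (fun v => M.inputAlphabet.symm ((decode v.2.1 v.2.2).getD none)) (jump fetch))
        (jump copy)
  -- The word is stored reversed, so it arrives on the input stack in its original order. The output
  -- stack keeps a copy for `restore`.
  | .inr copy => popWord <|
      branch (fun v => v.2.1.isSome)
        (push (.inl M.k₀) (fun v => M.inputAlphabet.symm v.2.1) <|
          push (.inr out) (fun v => (v.2.1.getD false : Bool)) (jump copy))
        (jump restore)
  | .inr restore => pop (.inr out) (fun v (a : Option Bool) => (v.1, a, none)) <|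
      branch (fun v => v.2.1.isSome)
        (push (.inr word) (fun v => (v.2.1.getD false : Bool)) (jump restore))
        (reset (goto fun _ => .inl M.main))
  | .inr done =>
      pop (.inl M.k₁) (fun v (a : Option (M.Γ M.k₁)) => (v.1, a.map M.outputAlphabet, none)) <|
      pop (.inr tally) (fun v (a : Option Bool) => (v.1, v.2.1, a)) <|
      branch (fun v => v.2.2.isNone)
        (push (.inr tally) (fun v => (v.2.1.getD false : Bool)) (jump skip)) <|
      -- The top of the tally has been popped: an equal vote restores it and adds one more, an
      -- opposite vote cancels it.
      branch (fun v => v.2.1 == v.2.2)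
        (push (.inr tally) (fun v => (v.2.1.getD false : Bool)) <|
          push (.inr tally) (fun v => (v.2.1.getD false : Bool)) (jump skip))
        (jump skip)
  | .inr skip => popInp₁ <|
      branch (fun v => v.2.1 == some false) (popInp₂ (jump skip)) (jump next)
  | .inr clearWord => popWord <|
      branch (fun v => v.2.1.isSome) (jump clearWord) (jump sign)
  | .inr sign => pop (.inr tally) (fun v (a : Option Bool) => (v.1, a, none)) <|
      branch (fun v => v.2.1 == some true) (jump (clearTally true)) (jump (clearTally false))
  | .inr (clearTally b) => pop (.inr tally) (fun v (a : Option Bool) => (v.1, a, none)) <|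
      branch (fun v => v.2.1.isSome) (jump (clearTally b))
        (push (.inr out) (fun _ => b) (reset halt))

variable (M) in
/-- The simulating machine. -/
def tm : FinTM2 where
  K := M.K ⊕ AuxStack
  kFin := @instFintypeSum _ _ M.kFin _
  k₀ := .inr inp
  k₁ := .inr out
  Γ := Γ M
  Λ := Label M
  main := .inr scan
  ΛFin := @instFintypeSum _ _ M.ΛFin _
  σ := State M
  initialState := (M.initialState, none, none)
  σFin := @instFintypeProd _ _ M.σFin _
  Γk₀Fin := inferInstanceAs (Fintype (Option Bool))
  m := stmt M

theorem finite_Γ (k) : Finite ((tm M).Γ k) := by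
  rcases k with k | k
  · exact M.alphabetFinite k
  · exact inferInstanceAs (Finite k.Γ)

/-- All stacks as one function. -/
def stk (S : ∀ k, List (M.Γ k)) (I : List (Option Bool)) (W O T : List Bool) :
    ∀ k, List (Γ M k)
  | .inl k => S k
  | .inr inp => I
  | .inr word => W
  | .inr out => O
  | .inr tally => T

section
variable (q : TM2.Stmt (Γ M) (Label M) (State M)) (v : State M) (S : ∀ k, List (M.Γ k))
  (I : List (Option Bool)) (W O T : List Bool)

theorem update_inl (k : M.K) (s : List (M.Γ k)) :
    Function.update (stk S I W O T) (.inl k) s = stk (Function.update S k s) I W O T := by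
  funext k'
  rcases k' with k' | k'
  · by_cases h : k' = k
    · subst h
      exact (Function.update_self (β := fun k => List (Γ M k)) _ _ _).trans
        (Function.update_self (β := fun k => List (M.Γ k)) _ _ _).symm
    · exact (Function.update_of_ne (β := fun k => List (Γ M k)) (by simpa using h) _ _).trans
        (Function.update_of_ne (β := fun k => List (M.Γ k)) h _ _).symm
  · cases k' <;> exact Function.update_of_ne (β := fun k => List (Γ M k)) (by simp) _ _

theorem stepAux_push_inl (k : M.K) (f : State M → M.Γ k) :
    TM2.stepAux (push (.inl k) f q) v (stk S I W O T) =
      TM2.stepAux q v (stk (Function.update S k (f v :: S k)) I W O T) :=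
  congrArg (TM2.stepAux q _) (update_inl ..)

theorem stepAux_pop_inl (k : M.K) (f : State M → Option (M.Γ k) → State M) :
    TM2.stepAux (pop (.inl k) f q) v (stk S I W O T) =
      TM2.stepAux q (f v (S k).head?) (stk (Function.update S k (S k).tail) I W O T) :=
  congrArg (TM2.stepAux q _) (update_inl ..)

theorem stepAux_peek_inp (f : State M → Option (Option Bool) → State M) :
    TM2.stepAux (peek (.inr inp) f q) v (stk S I W O T) =
      TM2.stepAux q (f v I.head?) (stk S I W O T) := rfl

theorem update_inp (I') :
    Function.update (stk S I W O T) (.inr inp) I' = stk S I' W O T := by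
  funext k
  rcases k with k | k
  · exact Function.update_of_ne (β := fun k => List (Γ M k)) (by simp) _ _
  · cases k <;> rfl

theorem update_word (W') :
    Function.update (stk S I W O T) (.inr word) W' = stk S I W' O T := by
  funext k
  rcases k with k | k
  · exact Function.update_of_ne (β := fun k => List (Γ M k)) (by simp) _ _
  · cases k <;> rfl

theorem update_out (O') :
    Function.update (stk S I W O T) (.inr out) O' = stk S I W O' T := by
  funext k
  rcases k with k | k
  · exact Function.update_of_ne (β := fun k => List (Γ M k)) (by simp) _ _
  · cases k <;> rfl

theorem update_tally (T') :
    Function.update (stk S I W O T) (.inr tally) T' = stk S I W O T' := by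
  funext k
  rcases k with k | k
  · exact Function.update_of_ne (β := fun k => List (Γ M k)) (by simp) _ _
  · cases k <;> rfl

theorem stepAux_popInp₁ : TM2.stepAux (popInp₁ q) v (stk S I W O T) =
    TM2.stepAux q (v.1, I.head?.join, v.2.2) (stk S I.tail W O T) :=
  congrArg (TM2.stepAux q _) (update_inp ..)

theorem stepAux_popInp₂ : TM2.stepAux (popInp₂ q) v (stk S I W O T) =
    TM2.stepAux q (v.1, v.2.1, I.head?.join) (stk S I.tail W O T) :=
  congrArg (TM2.stepAux q _) (update_inp ..)

theorem stepAux_popWord : TM2.stepAux (popWord q) v (stk S I W O T) =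
    TM2.stepAux q (v.1, W.head?, v.2.2) (stk S I W.tail O T) :=
  congrArg (TM2.stepAux q _) (update_word ..)

theorem stepAux_push_word (f : State M → Bool) :
    TM2.stepAux (push (.inr word) f q) v (stk S I W O T) =
      TM2.stepAux q v (stk S I (f v :: W) O T) :=
  congrArg (TM2.stepAux q _) (update_word ..)

theorem stepAux_push_out (f : State M → Bool) :
    TM2.stepAux (push (.inr out) f q) v (stk S I W O T) =
      TM2.stepAux q v (stk S I W (f v :: O) T) :=
  congrArg (TM2.stepAux q _) (update_out ..)

theorem stepAux_pop_out (f : State M → Option Bool → State M) :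
    TM2.stepAux (pop (.inr out) f q) v (stk S I W O T) =
      TM2.stepAux q (f v O.head?) (stk S I W O.tail T) :=
  congrArg (TM2.stepAux q _) (update_out ..)

theorem stepAux_push_tally (f : State M → Bool) :
    TM2.stepAux (push (.inr tally) f q) v (stk S I W O T) =
      TM2.stepAux q v (stk S I W O (f v :: T)) :=
  congrArg (TM2.stepAux q _) (update_tally ..)

theorem stepAux_pop_tally (f : State M → Option Bool → State M) :
    TM2.stepAux (pop (.inr tally) f q) v (stk S I W O T) =
      TM2.stepAux q (f v T.head?) (stk S I W O T.tail) :=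
  congrArg (TM2.stepAux q _) (update_tally ..)

theorem stepAux_reset (S : ∀ k, List (Γ M k)) :
    TM2.stepAux (reset q) v S = TM2.stepAux q (v.1, none, none) S := rfl

end

/-- The configuration of the simulating machine in which the simulated machine is in a given
configuration. -/
def simCfg (C : TM2.Cfg M.Γ M.Λ M.σ) (e : Option Bool × Option Bool) (I : List (Option Bool))
    (W O T : List Bool) : TM2.Cfg (Γ M) (Label M) (State M) :=
  ⟨some (C.l.elim (.inr done) .inl), (C.var, e), stk C.stk I W O T⟩

/-- An embedded statement touches only the state and stacks of `M`; the registers and added stacks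
are carried along. Halting of `M` becomes the label `done`, in accordance with `simCfg`. -/
theorem stepAux_embed (q : TM2.Stmt M.Γ M.Λ M.σ) (v e) (S : ∀ k, List (M.Γ k)) (I W O T) :
    TM2.stepAux (embed q) (v, e) (stk S I W O T) = simCfg (TM2.stepAux q v S) e I W O T := by
  induction q generalizing v S with
  | push k f q ih => rw [embed, stepAux_push_inl, ih, TM2.stepAux]
  | peek k f q ih => exact ih ..
  | pop k f q ih => exact (stepAux_pop_inl ..).trans (ih ..)
  | load f q ih => rw [embed, TM2.stepAux, ih, TM2.stepAux]
  | branch f q₁ q₂ ih₁ ih₂ =>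
    rw [embed, TM2.stepAux, ih₁, ih₂, TM2.stepAux]
    dsimp only
    cases f v <;> rfl
  | goto f => rfl
  | halt => rfl

end AdviceSimulation

/-! ### Single steps of the simulation -/

namespace AdviceSimulation
open Turing Turing.TM2.Stmt AuxStack AuxLabel

variable {M : ProbTM}

/-- A configuration between two phases of the simulation. -/
def cfg (l : AuxLabel) (S : ∀ k, List (M.Γ k)) (I : List (Option Bool)) (W O T : List Bool) :
    (tm M).Cfg :=
  ⟨some (.inr l), (M.initialState, none, none), stk S I W O T⟩

/-- The configuration of the simulating machine that corresponds to a configuration of `M`. -/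
def sim (C : M.Cfg) (I : List (Option Bool)) (W T : List Bool) : (tm M).Cfg :=
  simCfg C (none, none) I W [] T

/-- The stacks of `M` when the input stack contains `s` and the others are empty. -/
def inputStk (s : List (Option Bool)) : ∀ k, List (M.Γ k) :=
  Function.update (fun _ => []) M.k₀ (s.map M.inputAlphabet.symm)

/-- The empty stacks of `M`. -/
def emptyStk : ∀ k, List (M.Γ k) := fun _ => []

/-- The counter after an output of `M`: its entries are all equal, and their number is the majority
of this value. -/
def count (b : Bool) : List Bool → List Bool
  | [] => [b]
  | c :: T => if b = c then b :: b :: T else T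

theorem inputStk_nil : inputStk (M := M) [] = emptyStk := Function.update_eq_self _ _

theorem update_inputStk (s : List (Option Bool)) (c : Option Bool) :
    Function.update (inputStk s) M.k₀ (M.inputAlphabet.symm c :: inputStk s M.k₀) =
      inputStk (c :: s) := by
  simp [inputStk]

theorem step_cfg (l : AuxLabel) (S : ∀ k, List (M.Γ k)) (I W O T) :
    (tm M).step (cfg l S I W O T) =
      some (TM2.stepAux (stmt M (.inr l)) (M.initialState, none, none) (stk S I W O T)) := rfl

variable (S : ∀ k, List (M.Γ k)) (I : List (Option Bool)) (W O T : List Bool)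

theorem stepAux_branch (f : State M → Bool) (q₁ q₂ : TM2.Stmt (Γ M) (Label M) (State M)) (v)
    (S : ∀ k, List (Γ M k)) : TM2.stepAux (branch f q₁ q₂) v S =
      if f v then TM2.stepAux q₁ v S else TM2.stepAux q₂ v S := by
  rw [TM2.stepAux]; cases f v <;> rfl

theorem step_scan_some (b : Bool) :
    (tm M).step (cfg scan S (some b :: I) W O T) = some (cfg scan S I (b :: W) O T) := by
  rw [step_cfg, stmt, stepAux_popInp₁, stepAux_branch, stepAux_push_word]
  rfl

theorem step_scan_none :
    (tm M).step (cfg scan S (none :: I) W O T) = some (cfg next S I W O T) := by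
  rw [step_cfg, stmt, stepAux_popInp₁, stepAux_branch]
  rfl

theorem step_next_nil :
    (tm M).step (cfg next S [] W O T) = some (cfg clearWord S [] W O T) := by
  rw [step_cfg, stmt, stepAux_peek_inp, stepAux_branch]
  rfl

theorem step_next_cons (c : Option Bool) :
    (tm M).step (cfg next S (c :: I) W O T) = some (cfg fetch S (c :: I) W O T) := by
  rw [step_cfg, stmt, stepAux_peek_inp, stepAux_branch]
  rfl

theorem step_fetch_some (s : List (Option Bool)) (c : Option Bool)
    (h : decode I.head?.join I.tail.head?.join = some c) :
    (tm M).step (cfg fetch (inputStk s) I W O T) =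
      some (cfg fetch (inputStk (c :: s)) I.tail.tail W O T) := by
  rw [step_cfg, stmt, stepAux_popInp₁, stepAux_popInp₂, stepAux_branch, stepAux_push_inl,
    ← update_inputStk]
  simp only [h]
  rfl

theorem step_fetch_none (h : decode I.head?.join I.tail.head?.join = none) :
    (tm M).step (cfg fetch S I W O T) = some (cfg copy S I.tail.tail W O T) := by
  rw [step_cfg, stmt, stepAux_popInp₁, stepAux_popInp₂, stepAux_branch]
  simp only [h]
  rfl

theorem step_copy_cons (s : List (Option Bool)) (b : Bool) :
    (tm M).step (cfg copy (inputStk s) I (b :: W) O T) =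
      some (cfg copy (inputStk (some b :: s)) I W (b :: O) T) := by
  rw [step_cfg, stmt, stepAux_popWord, stepAux_branch, stepAux_push_inl, stepAux_push_out,
    ← update_inputStk]
  rfl

theorem step_copy_nil :
    (tm M).step (cfg copy S I [] O T) = some (cfg restore S I [] O T) := by
  rw [step_cfg, stmt, stepAux_popWord, stepAux_branch]
  rfl

theorem step_restore_cons (b : Bool) :
    (tm M).step (cfg restore S I W (b :: O) T) = some (cfg restore S I (b :: W) O T) := by
  rw [step_cfg, stmt, stepAux_pop_out, stepAux_branch, stepAux_push_word]
  rfl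

theorem step_restore_nil (s : List (Option Bool)) :
    (tm M).step (cfg restore (inputStk s) I W [] T) =
      some (sim (initList M.toFinTM2 (s.map M.inputAlphabet.symm)) I W T) := by
  rw [step_cfg, stmt, stepAux_pop_out, stepAux_branch, FinTM2.initList_eq]
  rfl

theorem step_sim (C : M.Cfg) (hC : C.l ≠ none) :
    (tm M).step (sim C I W T) =
      some (sim ((M.step (I.tail.head?.join == some true) C).getD C) I.tail.tail W T) := by
  obtain ⟨l, v, S⟩ := C
  cases l with
  | none => exact absurd rfl hC
  | some l =>
    refine Eq.trans (b := some (TM2.stepAux (stmt M (.inl l)) (v, none, none) (stk S I W [] T)))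
      rfl ?_
    rw [stmt, stepAux_popInp₁, stepAux_popInp₂, stepAux_branch, stepAux_reset, stepAux_reset,
      stepAux_embed, stepAux_embed]
    dsimp only
    cases (I.tail.head?.join == some true) <;> rfl

/-- A halted `M` is back in its initial state with only its output bit on the stacks. Popping this
bit leaves everything clean for the next round. -/
theorem step_done (b : Bool) :
    (tm M).step (sim (haltList M.toFinTM2 [M.outputAlphabet.symm b]) I W T) =
      some (cfg skip emptyStk I W [] (count b T)) := by
  rw [FinTM2.haltList_eq]
  refine Eq.trans (b := some (TM2.stepAux (stmt M (.inr done)) (M.initialState, none, none)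
    (stk (Function.update (fun _ => []) M.k₁ [M.outputAlphabet.symm b]) I W [] T))) rfl ?_
  rw [stmt, stepAux_pop_inl, stepAux_pop_tally, stepAux_branch, stepAux_branch, stepAux_push_tally,
    stepAux_push_tally, stepAux_push_tally]
  have h : Function.update (Function.update (fun _ => []) M.k₁ [M.outputAlphabet.symm b]) M.k₁ [] =
      emptyStk := by rw [Function.update_idem]; exact Function.update_eq_self _ _
  simp only [Function.update_self, List.head?_cons, Option.map_some, List.tail_cons, h,
    Equiv.apply_symm_apply]
  cases T with
  | nil => rfl
  | cons c T => cases b <;> cases c <;> rfl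

theorem step_skip_false :
    (tm M).step (cfg skip S (some false :: I) W O T) = some (cfg skip S I.tail W O T) := by
  rw [step_cfg, stmt, stepAux_popInp₁, stepAux_branch, stepAux_popInp₂]
  rfl

theorem step_skip (h : I.head? ≠ some (some false)) :
    (tm M).step (cfg skip S I W O T) = some (cfg next S I.tail W O T) := by
  rw [step_cfg, stmt, stepAux_popInp₁, stepAux_branch]
  rcases I with _ | ⟨_ | _ | _, I⟩
  · rfl
  · rfl
  · simp at h
  · rfl

theorem step_clearWord_cons (b : Bool) :
    (tm M).step (cfg clearWord S I (b :: W) O T) = some (cfg clearWord S I W O T) := by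
  rw [step_cfg, stmt, stepAux_popWord, stepAux_branch]
  rfl

theorem step_clearWord_nil :
    (tm M).step (cfg clearWord S I [] O T) = some (cfg sign S I [] O T) := by
  rw [step_cfg, stmt, stepAux_popWord, stepAux_branch]
  rfl

theorem step_sign :
    (tm M).step (cfg sign S I W O T) =
      some (cfg (clearTally (T.head?.getD false)) S I W O T.tail) := by
  rw [step_cfg, stmt, stepAux_pop_tally, stepAux_branch]
  rcases T with _ | ⟨_ | _, T⟩ <;> rfl

theorem step_clearTally_cons (b c : Bool) :
    (tm M).step (cfg (clearTally b) S I W O (c :: T)) = some (cfg (clearTally b) S I W O T) := by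
  rw [step_cfg, stmt, stepAux_pop_tally, stepAux_branch]
  rfl

theorem initList_eq (s : List (Option Bool)) :
    initList (tm M) s = cfg scan emptyStk s [] [] [] := by
  refine (FinTM2.initList_eq (tm M) s).trans (congrArg (TM2.Cfg.mk _ _) ?_)
  refine Eq.trans ?_ (update_inp (M := M) emptyStk [] [] [] [] s)
  congr 1
  funext k
  rcases k with k | k
  · rfl
  · cases k <;> rfl

theorem step_clearTally_nil (b : Bool) :
    (tm M).step (cfg (clearTally b) emptyStk [] [] [] []) = some (haltList (tm M) [b]) := by
  rw [step_cfg, stmt, stepAux_pop_tally, stepAux_branch, stepAux_push_out]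
  refine congrArg some (Eq.trans ?_ (FinTM2.haltList_eq (tm M) [b]).symm)
  refine congrArg (TM2.Cfg.mk _ _) ?_
  refine Eq.trans (update_out (M := M) emptyStk [] [] [] [] [b]).symm ?_
  congr 1
  funext k
  rcases k with k | k
  · rfl
  · cases k <;> rfl

end AdviceSimulation

namespace ProbTM

theorem run_of_halted (M : ProbTM) (cs : List Bool) (C : M.Cfg) (hC : C.l = none) :
    M.run cs C = C := by
  induction cs with
  | nil => rfl
  | cons c cs ih =>
    obtain ⟨l, v, S⟩ := C
    subst hC
    exact ih

end ProbTM

/-! ### Phases of the simulation, and its running time on arbitrary advice -/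

namespace AdviceSimulation
open Turing Turing.TM2.Stmt AuxStack AuxLabel FinTM2

variable {M : ProbTM} (S : ∀ k, List (M.Γ k)) (I : List (Option Bool)) (W O T : List Bool)

theorem within_scan (x : List Bool) :
    (tm M).Within (x.length + 1) (cfg scan S (x.map some ++ none :: I) W O T)
      (cfg next S I (x.reverse ++ W) O T) := by
  induction x generalizing W with
  | nil => exact .single (step_scan_none ..)
  | cons b x ih => simpa using Within.head (step_scan_some ..) (ih (b :: W))

theorem within_copy (s : List (Option Bool)) :
    (tm M).Within (W.length + 1) (cfg copy (inputStk s) I W O T)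
      (cfg restore (inputStk (W.reverse.map some ++ s)) I [] (W.reverse ++ O) T) := by
  induction W generalizing s O with
  | nil => exact .single (step_copy_nil ..)
  | cons b W ih => simpa using Within.head (step_copy_cons ..) (ih (b :: O) (some b :: s))

theorem within_restore (s : List (Option Bool)) :
    (tm M).Within (O.length + 1) (cfg restore (inputStk s) I W O T)
      (sim (initList M.toFinTM2 (s.map M.inputAlphabet.symm)) I (O.reverse ++ W) T) := by
  induction O generalizing W with
  | nil => exact .single (step_restore_nil ..)
  | cons b O ih => simpa using Within.head (step_restore_cons ..) (ih (b :: W))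

theorem within_clearWord :
    (tm M).Within (W.length + 1) (cfg clearWord S I W O T) (cfg sign S I [] O T) := by
  induction W with
  | nil => exact .single (step_clearWord_nil ..)
  | cons b W ih => exact Within.head (step_clearWord_cons ..) ih

theorem within_clearTally (b : Bool) :
    (tm M).Within (T.length + 1) (cfg (clearTally b) emptyStk [] [] [] T)
      (haltList (tm M) [b]) := by
  induction T with
  | nil => exact .single (step_clearTally_nil ..)
  | cons c T ih => exact Within.head (step_clearTally_cons ..) ih

/-- When the advice is used up, the sign of the counter is the output. -/
theorem within_finish :
    (tm M).Within (W.length + T.length + 4) (cfg next emptyStk [] W [] T)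
      (haltList (tm M) [T.head?.getD false]) := by
  refine ((Within.head (step_next_nil ..) ((within_clearWord ..).trans
    (Within.head (step_sign ..) (within_clearTally ..)))).mono ?_)
  simp; omega

/-- Copying the word on top of the input of `M`. -/
theorem within_copy_word (s : List (Option Bool)) (x : List Bool) :
    (tm M).Within (2 * x.length + 2) (cfg copy (inputStk s) I x.reverse [] T)
      (sim (initList M.toFinTM2 ((x.map some ++ s).map M.inputAlphabet.symm)) I x.reverse T) := by
  have h := (within_copy (M := M) I x.reverse [] T s).trans (within_restore ..)
  simp only [List.append_nil, List.reverse_reverse, List.length_reverse] at h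
  exact h.mono (by omega)

/-- Each fetched symbol uses up advice, which bounds the input built for `M`. The loss of at least
one symbol of nonempty advice is what makes the rounds terminate. -/
theorem exists_within_fetch (s : List (Option Bool)) :
    ∃ I' s', I'.length ≤ I.length - 1 ∧ s'.length ≤ s.length + I.length ∧
      (tm M).Within (I.length + 1) (cfg fetch (inputStk s) I W O T)
        (cfg copy (inputStk s') I' W O T) := by
  induction hn : I.length using Nat.strong_induction_on generalizing I s with
  | _ n ih =>
    rcases h : decode I.head?.join I.tail.head?.join with _ | c
    · exact ⟨I.tail.tail, s, by simp; omega, by omega,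
        (Within.single (step_fetch_none _ _ _ _ _ h)).mono (by omega)⟩
    · have hI : I ≠ [] := by rintro rfl; simp [decode] at h
      have hpos := List.length_pos_iff.2 hI
      obtain ⟨I', s', h₁, h₂, h₃⟩ := ih (I.tail.tail).length (by simp; omega) I.tail.tail (c :: s) rfl
      refine ⟨I', s', ?_, ?_, (Within.head (step_fetch_some _ _ _ _ _ _ h) h₃).mono ?_⟩ <;>
        simp at h₁ h₂ ⊢ <;> omega

theorem exists_within_skip :
    ∃ I', I'.length ≤ I.length ∧
      (tm M).Within (I.length + 1) (cfg skip S I W O T) (cfg next S I' W O T) := by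
  induction hn : I.length using Nat.strong_induction_on generalizing I with
  | _ n ih =>
    by_cases h : I.head? = some (some false)
    · obtain ⟨I, rfl⟩ : ∃ J, I = some false :: J := by
        cases I <;> simp at h; exact ⟨_, by rw [h]⟩
      simp only [List.length_cons] at hn
      obtain ⟨I', h₁, h₂⟩ := ih I.tail.length (by simp; omega) I.tail rfl
      refine ⟨I', ?_, (Within.head (step_skip_false ..) h₂).mono ?_⟩ <;> simp at h₁ ⊢ <;> omega
    · exact ⟨I.tail, by simp; omega, (Within.single (step_skip _ _ _ _ _ h)).mono (by omega)⟩

/-- The coins are whatever the advice supplies, so halting is assumed for all coin sequences. -/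
theorem exists_within_run (t : ℕ) (C : M.Cfg)
    (h : ∀ cs : List Bool, cs.length = t → (M.run cs C).l = none) :
    ∃ cs I', cs.length = t ∧ I'.length ≤ I.length ∧
      (tm M).Within t (sim C I W T) (sim (M.run cs C) I' W T) := by
  induction t generalizing C I with
  | zero => exact ⟨[], I, rfl, le_rfl, .refl _ _⟩
  | succ t ih =>
    by_cases hC : C.l = none
    -- Once `M` has halted, the remaining coins are arbitrary padding.
    · refine ⟨List.replicate (t + 1) false, I, by simp, le_rfl, ?_⟩
      rw [M.run_of_halted _ _ hC]
      exact .refl _ _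
    · set c := I.tail.head?.join == some true
      obtain ⟨cs, I', h₁, h₂, h₃⟩ := ih I.tail.tail ((M.step c C).getD C)
        fun cs hcs => h (c :: cs) (by simp [hcs])
      exact ⟨c :: cs, I', by simp [h₁], h₂.trans (by simp; omega),
        .head (step_sim _ _ _ _ hC) h₃⟩

/-- On any remaining advice, one round takes polynomial time and uses some of the advice. -/
theorem exists_within_round {t : ℕ → ℕ} (hM : M.RunsInTime t) (ht : Monotone t) (x : List Bool)
    (N : ℕ) (hN : x.length + I.length ≤ N) (hI : I ≠ []) :
    ∃ I' b, I'.length < I.length ∧ (tm M).Within (4 * N + t N + 6)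
      (cfg next emptyStk I x.reverse [] T) (cfg next emptyStk I' x.reverse [] (count b T)) := by
  obtain ⟨c, J, rfl⟩ := List.exists_cons_of_ne_nil hI
  obtain ⟨I₁, s, h₁, hs, w₁⟩ :=
    exists_within_fetch (M := M) (c :: J) x.reverse [] T []
  rw [inputStk_nil] at w₁
  have w₂ := within_copy_word (M := M) I₁ T s x
  set C := initList M.toFinTM2 ((x.map some ++ s).map M.inputAlphabet.symm)
  obtain ⟨cs, I₂, hcs, h₂, w₃⟩ := exists_within_run (M := M) I₁ x.reverse T
    (t (x.map some ++ s).length) C fun cs hcs => by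
      obtain ⟨b, hb⟩ := hM (x.map some ++ s) cs hcs
      exact congrArg TM2.Cfg.l (hb.trans (FinTM2.haltList_eq _ _))
  obtain ⟨b, hb⟩ := hM (x.map some ++ s) cs hcs
  rw [show M.run cs C = _ from hb] at w₃
  obtain ⟨I₃, h₃, w₄⟩ :=
    exists_within_skip (M := M) emptyStk I₂ x.reverse [] (count b T)
  refine ⟨I₃, b, ?_, (Within.head (step_next_cons ..) (w₁.trans (w₂.trans
    (w₃.trans (Within.head (step_done ..) w₄))))).mono ?_⟩
  · simp at h₁ ⊢; omega
  · have : t (x.length + s.length) ≤ t N := ht (by simp at hs hN ⊢; omega)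
    simp at h₁ hN ⊢; omega

theorem length_count_le (b : Bool) (T : List Bool) : (count b T).length ≤ T.length + 1 := by
  cases T with
  | nil => rfl
  | cons c T => by_cases h : b = c <;> simp [count, h]; omega

/-- Every round shortens the advice, so there are at most `I.length` of them. The constant `7` is
the `6` of one round plus one for the growth of the counter, which is cleared at the end. -/
theorem exists_within_rounds {t : ℕ → ℕ} (hM : M.RunsInTime t) (ht : Monotone t) (x : List Bool)
    (N : ℕ) (hN : x.length + I.length ≤ N) :
    ∃ b, (tm M).Within (I.length * (4 * N + t N + 7) + x.length + T.length + 4)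
      (cfg next emptyStk I x.reverse [] T) (haltList (tm M) [b]) := by
  induction hn : I.length using Nat.strong_induction_on generalizing I T with
  | _ n ih =>
    by_cases hI : I = []
    · subst hI
      exact ⟨_, (within_finish ..).mono (by simp)⟩
    · obtain ⟨I', b, hI', w⟩ := exists_within_round I T hM ht x N hN hI
      obtain ⟨b', w'⟩ := ih I'.length (hn ▸ hI') I' (count b T) (by omega) rfl
      refine ⟨b', (w.trans w').mono ?_⟩
      have h₁ := length_count_le b T
      have h₂ : (I'.length + 1) * (4 * N + t N + 7) ≤ n * (4 * N + t N + 7) :=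
        Nat.mul_le_mul_right _ (by omega)
      rw [Nat.add_mul] at h₂
      omega

/-- On every word and every advice the simulation halts with one output bit in polynomial time. -/
theorem exists_within_halt {t : ℕ → ℕ} (hM : M.RunsInTime t) (ht : Monotone t) (x a : List Bool) :
    ∃ b, (tm M).Within ((x.length + 1 + a.length) * (4 * (x.length + 1 + a.length) +
        t (x.length + 1 + a.length) + 7) + 2 * (x.length + 1 + a.length) + 4)
      (initList (tm M) (x.map some ++ none :: a.map some)) (haltList (tm M) [b]) := by
  obtain ⟨b, w⟩ := exists_within_rounds (a.map some) [] hM ht x (x.length + 1 + a.length)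
    (by simp)
  have w₀ := within_scan (M := M) emptyStk (a.map some) [] [] [] x
  rw [List.append_nil] at w₀
  refine ⟨b, ((w₀.trans w).congr_left (initList_eq _).symm).mono ?_⟩
  have : a.length * (4 * (x.length + 1 + a.length) + t (x.length + 1 + a.length) + 7) ≤
    (x.length + 1 + a.length) * (4 * (x.length + 1 + a.length) + t (x.length + 1 + a.length) + 7) :=
    Nat.mul_le_mul_right _ (by omega)
  simp; omega

end AdviceSimulation

/-! ### Correctness on the intended advice -/

namespace AdviceSimulation
open Turing Turing.TM2.Stmt AuxStack AuxLabel FinTM2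

/-- The two bits that code a symbol. -/
def encodeSymbol : Option Bool → List Bool
  | some c => [false, c]
  | none => [true, false]

/-- The part of the advice that describes one run of `M`: the symbols to be put on its input stack
below the word, and its coins. -/
def encodeRun (r : List (Option Bool) × List Bool) : List Bool :=
  -- The symbols are reversed because they are pushed in reading order. `11` ends them, and a `1` in
  -- the place of a marker ends the coins.
  r.1.reverse.flatMap encodeSymbol ++ [true, true] ++ r.2.flatMap (fun c => [false, c]) ++ [true]

theorem length_encodeRun (r : List (Option Bool) × List Bool) :
    (encodeRun r).length = 2 * r.1.length + 2 * r.2.length + 3 := by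
  have h₁ : ∀ s : List (Option Bool), (s.flatMap encodeSymbol).length = 2 * s.length := by
    intro s
    induction s with
    | nil => rfl
    | cons c s ih => rcases c with _ | c <;> simp [encodeSymbol] at ih ⊢ <;> omega
  have h₂ : ∀ s : List Bool, (s.flatMap (fun c => [false, c])).length = 2 * s.length := by
    intro s
    induction s with
    | nil => rfl
    | cons c s ih => simp at ih ⊢; omega
  simp only [encodeRun, List.length_append, h₁, h₂]
  simp; omega

variable {M : ProbTM} (S : ∀ k, List (M.Γ k)) (I : List Bool) (W O T : List Bool)

theorem within_fetch (s s' : List (Option Bool)) :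
    (tm M).Within (s.length + 1)
      (cfg fetch (inputStk s') ((s.flatMap encodeSymbol ++ true :: true :: I).map some) W O T)
      (cfg copy (inputStk (s.reverse ++ s')) (I.map some) W O T) := by
  induction s generalizing s' with
  | nil => exact .single (step_fetch_none _ _ _ _ _ rfl)
  | cons c s ih =>
    rw [List.reverse_cons, List.append_assoc]
    refine Within.head ?_ (ih (c :: s'))
    rcases c with _ | c <;> exact step_fetch_some _ _ _ _ _ _ rfl

theorem within_skip (cs : List Bool) :
    (tm M).Within (cs.length + 1)
      (cfg skip S ((cs.flatMap (fun c => [false, c]) ++ true :: I).map some) W O T)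
      (cfg next S (I.map some) W O T) := by
  induction cs with
  | nil => exact .single (step_skip _ _ _ _ _ (by simp))
  | cons c cs ih => exact Within.head (step_skip_false ..) ih

/-- `M` may halt early; `cs'` are the unused coins, left to `skip`. -/
theorem exists_within_run_coins (cs : List Bool) (C : M.Cfg) (h : (M.run cs C).l = none) :
    ∃ cs' : List Bool, (tm M).Within cs.length
      (sim C ((cs.flatMap (fun c => [false, c]) ++ I).map some) W T)
      (sim (M.run cs C) ((cs'.flatMap (fun c => [false, c]) ++ I).map some) W T) := by
  induction cs generalizing C with
  | nil => exact ⟨[], .refl _ _⟩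
  | cons c cs ih =>
    by_cases hC : C.l = none
    · refine ⟨c :: cs, ?_⟩
      rw [M.run_of_halted _ _ hC]
      exact .refl _ _
    · obtain ⟨cs', w⟩ := ih _ h
      refine ⟨cs', .head ((step_sim _ _ _ _ hC).trans ?_) w⟩
      cases c <;> rfl

theorem exists_within_encodeRun (x : List Bool) (r : List (Option Bool) × List Bool) (b : Bool)
    (h : M.Outputs (x.map some ++ r.1) r.2 b) :
    ∃ n, (tm M).Within n (cfg next emptyStk ((encodeRun r ++ I).map some) x.reverse [] T)
      (cfg next emptyStk (I.map some) x.reverse [] (count b T)) := by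
  obtain ⟨s, cs⟩ := r
  set J := cs.flatMap (fun c => [false, c]) ++ true :: I
  have hI : encodeRun (s, cs) ++ I = s.reverse.flatMap encodeSymbol ++ true :: true :: J := by
    simp [encodeRun, J]
  have w₀ : ∃ c K, encodeRun (s, cs) ++ I = c :: K := by
    rw [← List.ne_nil_iff_exists_cons, hI]; simp
  obtain ⟨c, K, hK⟩ := w₀
  have w₀ := step_next_cons (M := M) emptyStk (K.map some) x.reverse [] T (some c)
  rw [← List.map_cons, ← hK, hI] at w₀
  have w₁ := within_fetch (M := M) J x.reverse [] T s.reverse []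
  rw [List.append_nil, List.reverse_reverse, inputStk_nil] at w₁
  have w₂ := within_copy_word (M := M) (J.map some) T s x
  have hh : M.run cs (initList M.toFinTM2 ((x.map some ++ s).map M.inputAlphabet.symm)) = _ := h
  obtain ⟨cs', w₃⟩ := exists_within_run_coins (M := M) (true :: I) x.reverse T cs
    (initList M.toFinTM2 ((x.map some ++ s).map M.inputAlphabet.symm))
    (congrArg TM2.Cfg.l (hh.trans (FinTM2.haltList_eq _ _)))
  rw [hh] at w₃
  rw [hI]
  exact ⟨_, Within.head w₀ (w₁.trans (w₂.trans (w₃.trans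
    (Within.head (step_done ..) (within_skip ..)))))⟩

theorem exists_within_flatMap (x : List Bool) (rs : List (List (Option Bool) × List Bool))
    (out : List (Option Bool) × List Bool → Bool)
    (h : ∀ r ∈ rs, M.Outputs (x.map some ++ r.1) r.2 (out r)) :
    ∃ n, (tm M).Within n (cfg next emptyStk ((rs.flatMap encodeRun).map some) x.reverse [] T)
      (cfg next emptyStk [] x.reverse [] ((rs.map out).foldl (fun T b => count b T) T)) := by
  induction rs generalizing T with
  | nil => exact ⟨0, .refl _ _⟩
  | cons r rs ih =>
    obtain ⟨n₁, w₁⟩ := exists_within_encodeRun (rs.flatMap encodeRun) T x r (out r) (h r (by simp))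
    obtain ⟨n₂, w₂⟩ := ih (count (out r) T) fun r hr => h r (by simp [hr])
    exact ⟨_, w₁.trans w₂⟩

/-- The counter is an integer `m` in unary: `|m|` copies of `d` or of `!d` according to its sign. A
vote for `d` adds one, any other subtracts one; zero is the empty list. -/
theorem foldl_count (d : Bool) (bs : List Bool) (m : ℤ) :
    bs.foldl (fun T b => count b T) (List.replicate m.natAbs (if 0 ≤ m then d else !d)) =
      List.replicate (m + bs.count d - bs.count (!d)).natAbs
        (if 0 ≤ m + bs.count d - bs.count (!d) then d else !d) := by
  induction bs generalizing m with
  | nil => simp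
  | cons b bs ih =>
    have key : count b (List.replicate m.natAbs (if 0 ≤ m then d else !d)) =
        List.replicate (m + if b = d then 1 else -1).natAbs
          (if 0 ≤ (m + if b = d then 1 else -1) then d else !d) := by
      have hd : b ≠ d → b = !d := by cases b <;> cases d <;> simp
      rcases lt_trichotomy m 0 with hm | rfl | hm
      · obtain ⟨n, hn⟩ : ∃ n, m.natAbs = n + 1 := ⟨m.natAbs - 1, by omega⟩
        have h0 : ¬ 0 ≤ m := by omega
        by_cases hb : b = d
        · subst hb
          rw [hn, List.replicate_succ, if_neg h0, count, if_neg (by simp), if_pos rfl]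
          obtain rfl | h := n.eq_zero_or_pos
          · rw [show (m + 1).natAbs = 0 by omega]; rfl
          · have h1 : ¬ 0 ≤ m + 1 := by omega
            rw [show (m + 1).natAbs = n by omega, if_neg h1]
        · have h1 : ¬ 0 ≤ m + -1 := by omega
          rw [hn, List.replicate_succ, if_neg h0, count, if_pos (hd hb), if_neg hb, if_neg h1,
            show (m + -1).natAbs = n + 2 by omega, hd hb]
          rfl
      · by_cases hb : b = d
        · simp [hb, count]
        · simp [count, hd hb]
      · obtain ⟨n, hn⟩ : ∃ n, m.natAbs = n + 1 := ⟨m.natAbs - 1, by omega⟩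
        have h0 : 0 ≤ m := hm.le
        by_cases hb : b = d
        · subst hb
          have h1 : 0 ≤ m + 1 := by omega
          rw [hn, List.replicate_succ, if_pos h0, count, if_pos rfl, if_pos rfl, if_pos h1,
            show (m + 1).natAbs = n + 2 by omega]
          rfl
        · have h1 : 0 ≤ m + -1 := by omega
          rw [hn, List.replicate_succ, if_pos h0, count, if_neg hb, if_neg hb, if_pos h1,
            show (m + -1).natAbs = n by omega]
    rw [List.foldl_cons, key, ih]
    have : (m + if b = d then 1 else -1) + bs.count d - bs.count (!d) =
        m + (b :: bs).count d - (b :: bs).count (!d) := by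
      cases b <;> cases d <;> simp <;> omega
    rw [this]

/-- The counter decides the majority. -/
theorem head?_foldl_count (d : Bool) (bs : List Bool) (h : bs.count (!d) < bs.count d) :
    (bs.foldl (fun T b => count b T) []).head?.getD false = d := by
  have := foldl_count d bs 0
  simp only [Int.natAbs_zero, List.replicate_zero] at this
  rw [this, if_pos (by omega)]
  obtain ⟨n, hn⟩ : ∃ n, (0 + (bs.count d : ℤ) - bs.count (!d)).natAbs = n + 1 :=
    ⟨(0 + (bs.count d : ℤ) - bs.count (!d)).natAbs - 1, by omega⟩
  rw [hn]; rfl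

/-- If the majority of the runs described by the advice outputs `d`, then so does the
simulation. -/
theorem exists_within_majority (x : List Bool) (rs : List (List (Option Bool) × List Bool))
    (out : List (Option Bool) × List Bool → Bool) (d : Bool)
    (h : ∀ r ∈ rs, M.Outputs (x.map some ++ r.1) r.2 (out r))
    (hd : (rs.map out).count (!d) < (rs.map out).count d) :
    ∃ n, (tm M).Within n (initList (tm M) (x.map some ++ none :: (rs.flatMap encodeRun).map some))
      (haltList (tm M) [d]) := by
  have w₁ := within_scan (M := M) emptyStk ((rs.flatMap encodeRun).map some) [] [] [] x
  rw [List.append_nil] at w₁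
  obtain ⟨n, w₂⟩ := exists_within_flatMap (M := M) [] x rs out h
  have w₃ := within_finish (M := M) x.reverse ((rs.map out).foldl (fun T b => count b T) [])
  rw [head?_foldl_count d _ hd] at w₃
  exact ⟨_, ((w₁.trans (w₂.trans w₃)).congr_left (initList_eq _).symm)⟩

end AdviceSimulation

theorem Polynomial.monotone_eval_nat (p : Polynomial ℕ) : Monotone fun n => p.eval n := by
  intro a b hab
  induction p using Polynomial.induction_on' with
  | add p q hp hq => simpa using add_le_add hp hq
  | monomial n c => simpa using Nat.mul_le_mul_left c (Nat.pow_le_pow_left hab n)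

/-! ### Choosing good trials by multiplicative weights -/

section Averaging

variable {X R : Type*}

open Classical in
/-- The factor by which a trial changes the weight of `x`. -/
noncomputable def trialFactor (good : X → R → Prop) (x : X) (r : R) : ℝ :=
  if good x r then 2 / 3 else 3 / 2

theorem trialFactor_nonneg (good : X → R → Prop) (x : X) (r : R) : 0 ≤ trialFactor good x r := by
  unfold trialFactor; split_ifs <;> norm_num

-- If a trial is good with probability `q ≥ 2/3`, the expected factor is `3/2 - (5/6) q ≤ 17/18`.
open Classical in
theorem sum_mul_trialFactor_le [Fintype R] {w : R → ℝ} (hsum : ∑ r, w r = 1) {good : X → R → Prop} {x : X}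
    (h : 2 / 3 ≤ ∑ r, if good x r then w r else 0) :
    ∑ r, w r * trialFactor good x r ≤ 17 / 18 := by
  have : ∀ r, w r * trialFactor good x r = 3 / 2 * w r - 5 / 6 * if good x r then w r else 0 := by
    intro r; unfold trialFactor; split_ifs <;> ring
  simp only [this, Finset.sum_sub_distrib, ← Finset.mul_sum, hsum]
  linarith

-- The total weight starts at `|X|`. A random next trial multiplies it by at most `17/18` on
-- average, so some trial does at least as well.
open Classical in
theorem exists_list_sum_prod_le [Fintype X] [Fintype R] {w : R → ℝ} (hw : ∀ r, 0 ≤ w r) (hsum : ∑ r, w r = 1)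
    {good : X → R → Prop} (h : ∀ x, 2 / 3 ≤ ∑ r, if good x r then w r else 0) (k : ℕ) :
    ∃ rs : List R, rs.length = k ∧
      ∑ x, (rs.map (trialFactor good x)).prod ≤ Fintype.card X * (17 / 18 : ℝ) ^ k := by
  induction k with
  | zero => exact ⟨[], rfl, by simp⟩
  | succ k ih =>
    obtain ⟨rs, hk, hrs⟩ := ih
    set φ : X → ℝ := fun x => (rs.map (trialFactor good x)).prod
    have hφ : ∀ x, 0 ≤ φ x := fun x => List.prod_nonneg fun a ha => by
      obtain ⟨r, -, rfl⟩ := List.mem_map.1 ha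
      exact trialFactor_nonneg ..
    have hle : ∑ r, w r * ∑ x, trialFactor good x r * φ x ≤ 17 / 18 * ∑ x, φ x := by
      simp only [Finset.mul_sum, ← mul_assoc]
      rw [Finset.sum_comm]
      refine Finset.sum_le_sum fun x _ => ?_
      rw [← Finset.sum_mul]
      exact mul_le_mul_of_nonneg_right (sum_mul_trialFactor_le hsum (h x)) (hφ x)
    obtain ⟨r, hr⟩ : ∃ r, ∑ x, trialFactor good x r * φ x ≤ 17 / 18 * ∑ x, φ x := by
      by_contra! hlt
      obtain ⟨r₀, hr₀⟩ : ∃ r, 0 < w r := by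
        by_contra! hle
        linarith [Finset.sum_nonpos fun r (_ : r ∈ Finset.univ) => hle r]
      refine hle.not_gt ?_
      calc 17 / 18 * ∑ x, φ x = ∑ r, w r * (17 / 18 * ∑ x, φ x) := by
            rw [← Finset.sum_mul, hsum, one_mul]
        _ < _ := Finset.sum_lt_sum (fun r _ => mul_le_mul_of_nonneg_left (hlt r).le (hw r))
            ⟨r₀, Finset.mem_univ _, mul_lt_mul_of_pos_left (hlt r₀) hr₀⟩
    refine ⟨r :: rs, by simp [hk], ?_⟩
    simp only [List.map_cons, List.prod_cons]
    refine hr.trans ?_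
    rw [pow_succ]
    linarith

open Classical in
theorem prod_trialFactor (good : X → R → Prop) (x : X) (rs : List R) :
    (rs.map (trialFactor good x)).prod =
      (2 / 3) ^ rs.countP (fun r => good x r) * (3 / 2) ^ rs.countP (fun r => ¬ good x r) := by
  induction rs with
  | nil => simp
  | cons r rs ih =>
    rw [List.map_cons, List.prod_cons, ih, trialFactor]
    by_cases h : good x r <;> simp [h, pow_succ] <;> ring

open Classical in
/-- If every `x` is treated well by a random trial with probability at least `2 / 3`, then some list
of `k` trials treats every `x` well in the majority of its entries, as soon as
`|X| (17/18) ^ k < 1`. -/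
theorem exists_list_majority [Fintype X] [Fintype R] {w : R → ℝ} (hw : ∀ r, 0 ≤ w r) (hsum : ∑ r, w r = 1)
    {good : X → R → Prop} (h : ∀ x, 2 / 3 ≤ ∑ r, if good x r then w r else 0) {k : ℕ}
    (hk : Fintype.card X * (17 / 18 : ℝ) ^ k < 1) :
    ∃ rs : List R, rs.length = k ∧
      ∀ x, rs.countP (fun r => ¬ good x r) < rs.countP (fun r => good x r) := by
  obtain ⟨rs, hl, hrs⟩ := exists_list_sum_prod_le hw hsum h k
  refine ⟨rs, hl, fun x => ?_⟩
  by_contra! hle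
  have h₁ : (rs.map (trialFactor good x)).prod ≤ ∑ x, (rs.map (trialFactor good x)).prod :=
    Finset.single_le_sum (f := fun x => (rs.map (trialFactor good x)).prod)
      (fun x _ => List.prod_nonneg fun a ha => by
        obtain ⟨r, -, rfl⟩ := List.mem_map.1 ha
        exact trialFactor_nonneg ..) (Finset.mem_univ x)
  -- The factors `2/3` and `3/2` are inverse to each other, so without a good majority the weight of
  -- `x` is at least `1`.
  have h₂ : (1 : ℝ) ≤ (rs.map (trialFactor good x)).prod := by
    rw [prod_trialFactor]
    calc (1 : ℝ) = (2 / 3) ^ rs.countP (fun r => good x r) *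
          (3 / 2) ^ rs.countP (fun r => good x r) := by rw [← mul_pow]; norm_num
      _ ≤ _ := mul_le_mul_of_nonneg_left (pow_le_pow_right₀ (by norm_num) hle) (by positivity)
  linarith

end Averaging

/-- `13 (n + 1)` trials suffice for the words of length `n`. -/
theorem two_pow_mul_lt_one (n : ℕ) : (2 : ℝ) ^ n * (17 / 18) ^ (13 * (n + 1)) < 1 := by
  -- `13` is the least exponent with this property.
  have h : (17 / 18 : ℝ) ^ 13 ≤ 1 / 2 := by norm_num
  calc (2 : ℝ) ^ n * (17 / 18) ^ (13 * (n + 1)) = 2 ^ n * ((17 / 18) ^ 13) ^ (n + 1) := by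
        rw [← pow_mul]
    _ ≤ 2 ^ n * (1 / 2) ^ (n + 1) := by gcongr
    _ = 1 / 2 := by rw [pow_succ, ← mul_assoc, ← mul_pow]; norm_num
    _ < 1 := by norm_num

/-! ### From success probability to advice -/

theorem PMF.sum_prod_eq_one {n p : ℕ} (μ : PMF (Fin n → Bool)) :
    ∑ y : Fin p → (Fin n → Bool), ∏ i, μ (y i) = 1 := by
  have := Finset.prod_univ_sum (fun _ : Fin p => (Finset.univ : Finset (Fin n → Bool)))
    (fun _ z => μ z)
  rw [Fintype.piFinset_univ] at this
  rw [← this, ← tsum_fintype (L := .unconditional _), μ.tsum_coe]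
  simp

/-- Each example takes a separator, `n` letters and a label. The length does not depend on the
points, so the number of coins is fixed and trials form a product space. -/
theorem length_encodeTraining (L : Language Bool) {n p : ℕ} (x : List Bool)
    (y : Fin p → (Fin n → Bool)) :
    (encodeTraining x (trainingSet L y)).length = x.length + p * (n + 2) := by
  simp [encodeTraining, trainingSet, List.length_flatMap, Function.comp_def]

namespace ProbTM

theorem Outputs.unique {M : ProbTM} {s : List (Option Bool)} {cs : List Bool} {b c : Bool}
    (hb : M.Outputs s cs b) (hc : M.Outputs s cs c) : b = c := by
  have := Turing.FinTM2.haltList_injective _ (hb.symm.trans hc)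
  simpa using this

open Classical in
theorem outputProb_eq_sum (M : ProbTM) (t : ℕ) (s : List (Option Bool)) (b : Bool) :
    M.outputProb t s b =
      ∑ cs : Fin t → Bool, if M.Outputs s (List.ofFn cs) b then ((2 : ℝ≥0∞) ^ t)⁻¹ else 0 := by
  rw [outputProb, Nat.card_eq_fintype_card, Fintype.card_subtype, ← Finset.sum_filter,
    Finset.sum_const, nsmul_eq_mul, div_eq_mul_inv]

end ProbTM

open Classical in
/-- The success probability as a sum over the training points and the coins. -/
theorem successProb_eq_sum (M : ProbTM) (t : ℕ → ℕ) {n : ℕ} (μ : PMF (Fin n → Bool)) (p : ℕ)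
    (L : Language Bool) (x : List Bool) (T : ℕ) (hT : t (x.length + p * (n + 2)) = T) :
    successProb M t μ p L x = ∑ r : (Fin p → (Fin n → Bool)) × (Fin T → Bool),
      if M.Outputs (encodeTraining x (trainingSet L r.1)) (List.ofFn r.2) (decide (x ∈ L)) then
        (∏ i, μ (r.1 i)) * ((2 : ℝ≥0∞) ^ T)⁻¹ else 0 := by
  subst hT
  simp only [successProb, length_encodeTraining, ProbTM.outputProb_eq_sum, Fintype.sum_prod_type,
    Finset.mul_sum, mul_ite, mul_zero]

theorem sum_trial_weight {n : ℕ} (μ : PMF (Fin n → Bool)) (p T : ℕ) :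
    ∑ r : (Fin p → (Fin n → Bool)) × (Fin T → Bool), (∏ i, μ (r.1 i)) * ((2 : ℝ≥0∞) ^ T)⁻¹ = 1 := by
  simp only [Fintype.sum_prod_type, Finset.sum_const, nsmul_eq_mul, ← Finset.sum_mul,
    ← Finset.mul_sum, PMF.sum_prod_eq_one]
  simp [ENNReal.mul_inv_cancel]

open Classical in
/-- Some `13 (n + 1)` choices of training points and coins decide every word of length `n` by
majority. -/
theorem exists_list_trials {M : ProbTM} {t : ℕ → ℕ} {n : ℕ} {μ : PMF (Fin n → Bool)} {p : ℕ}
    {L : Language Bool} (h : ∀ x : List Bool, x.length = n → 2 / 3 ≤ successProb M t μ p L x)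
    (T : ℕ) (hT : t (n + p * (n + 2)) = T) :
    ∃ rs : List ((Fin p → (Fin n → Bool)) × (Fin T → Bool)), rs.length = 13 * (n + 1) ∧
      ∀ x : List Bool, x.length = n →
        rs.countP (fun r => ¬ M.Outputs (encodeTraining x (trainingSet L r.1)) (List.ofFn r.2)
          (decide (x ∈ L))) <
        rs.countP (fun r => M.Outputs (encodeTraining x (trainingSet L r.1)) (List.ofFn r.2)
          (decide (x ∈ L))) := by
  set w : (Fin p → (Fin n → Bool)) × (Fin T → Bool) → ℝ≥0∞ :=
    fun r => (∏ i, μ (r.1 i)) * ((2 : ℝ≥0∞) ^ T)⁻¹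
  have hsum : ∑ r, w r = 1 := sum_trial_weight μ p T
  have hfin : ∀ r, w r ≠ ⊤ := fun r hr => by
    have := Finset.single_le_sum (f := w) (fun _ _ => zero_le) (Finset.mem_univ r)
    rw [hr, hsum] at this
    simp at this
  obtain ⟨rs, hl, hrs⟩ := exists_list_majority (X := Fin n → Bool) (w := fun r => (w r).toReal)
    (good := fun x r => M.Outputs (encodeTraining (List.ofFn x) (trainingSet L r.1))
      (List.ofFn r.2) (decide (List.ofFn x ∈ L))) (k := 13 * (n + 1))
    (fun _ => ENNReal.toReal_nonneg)
    (by rw [← ENNReal.toReal_sum fun r _ => hfin r, hsum, ENNReal.toReal_one])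
    (fun x => by
      have hx := h (List.ofFn x) (by simp)
      rw [successProb_eq_sum M t μ p L _ T (by simpa using hT)] at hx
      have := ENNReal.toReal_mono ?_ hx
      · rw [ENNReal.toReal_sum fun r _ => ?_] at this
        · refine le_trans (by simp) (this.trans (le_of_eq (Finset.sum_congr rfl fun r _ => ?_)))
          split_ifs <;> simp [w]
        · split_ifs
          exacts [hfin r, ENNReal.zero_ne_top]
      · refine ne_top_of_le_ne_top ENNReal.one_ne_top (hsum ▸ Finset.sum_le_sum fun r _ => ?_)
        split_ifs
        exacts [le_rfl, zero_le])
    (by simpa using two_pow_mul_lt_one n)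
  refine ⟨rs, hl, ?_⟩
  rintro x rfl
  simpa [List.ofFn_get] using hrs x.get

/-- The part of the input of a machine that describes the training set. -/
def trainingWord (T : List (List Bool × Bool)) : List (Option Bool) :=
  T.flatMap (fun yb => none :: (yb.1.map some ++ [some yb.2]))

theorem BPPSamp_subset_PPoly (D : (n : ℕ) → PMF (Fin n → Bool)) : BPPSamp D ⊆ PPoly := by
  classical
  rintro L ⟨M, t, p, hM, h⟩
  have ht := t.monotone_eval_nat
  have h' : ∀ (n : ℕ) (x : List Bool), x.length = n →
      2 / 3 ≤ successProb M (fun n => t.eval n) (D n) (p.eval n) L x := by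
    rintro _ x rfl
    exact h x
  choose rs hl hrs using fun n => exists_list_trials (h' n) _ rfl
  let code (n : ℕ) (r : (Fin (p.eval n) → (Fin n → Bool)) ×
      (Fin (t.eval (n + p.eval n * (n + 2))) → Bool)) : List (Option Bool) × List Bool :=
    (trainingWord (trainingSet L r.1), List.ofFn r.2)
  have hword : ∀ (x : List Bool) (r : _), x.map some ++ (code x.length r).1 =
      encodeTraining x (trainingSet L r.1) := fun _ _ => rfl
  have hcode : ∀ (n : ℕ) (r : _), (code n r).1.length = p.eval n * (n + 2) := fun n r =>
    (length_encodeTraining L [] r.1).trans (by simp)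
  refine mem_PPoly_of_within (AdviceSimulation.tm M) AdviceSimulation.finite_Γ (Equiv.refl _)
    (Equiv.refl _)
    (Polynomial.X * (4 * Polynomial.X + t + 7) + 2 * Polynomial.X + 4) (fun x a => ?_)
    (fun n => ((rs n).map (code n)).flatMap AdviceSimulation.encodeRun)
    (13 * (Polynomial.X + 1) * (2 * (p * (Polynomial.X + 2)) +
      2 * t.comp (Polynomial.X + p * (Polynomial.X + 2)) + 3)) (fun n => ?_) (fun x => ?_)
  · obtain ⟨b, w⟩ := AdviceSimulation.exists_within_halt hM ht x a
    exact ⟨b, (w.congr_left (congrArg (Turing.initList (AdviceSimulation.tm M))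
      (List.map_id _).symm)).mono (by simp)⟩
  · have hr : ((rs n).map (code n)).map (fun r => (AdviceSimulation.encodeRun r).length) =
        List.replicate (rs n).length
          (2 * (p.eval n * (n + 2)) + 2 * t.eval (n + p.eval n * (n + 2)) + 3) := by
      rw [List.map_map, List.map_eq_replicate_iff]
      intro r _
      simp only [Function.comp_apply, AdviceSimulation.length_encodeRun, hcode]
      simp [code]
    rw [List.length_flatMap, hr]
    simp [hl]
  · set d := decide (x ∈ L) with hd
    -- By `hM` each listed run outputs some bit, so one that does not output `d` outputs `!d`.
    let out (r : List (Option Bool) × List Bool) : Bool :=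
      if M.Outputs (x.map some ++ r.1) r.2 d then d else !d
    have h₁ : ∀ r ∈ (rs x.length).map (code x.length),
        M.Outputs (x.map some ++ r.1) r.2 (out r) := fun r hr => by
      obtain ⟨r, -, rfl⟩ := List.mem_map.1 hr
      obtain ⟨b, hb⟩ := hM (x.map some ++ (code x.length r).1) (code x.length r).2
        (by rw [List.length_append, hcode]; simp [code])
      simp only [out]
      split_ifs with hO
      · exact hO
      · have : b ≠ d := by rintro rfl; exact hO hb
        rwa [← Bool.eq_not_iff.2 this]
    have h₂ : (((rs x.length).map (code x.length)).map out).count (!d) <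
        (((rs x.length).map (code x.length)).map out).count d := by
      convert hrs x.length x rfl using 1 <;>
      · rw [List.map_map, List.count, List.countP_map]
        refine List.countP_congr fun r _ => ?_
        simp only [Function.comp_apply, out, hword]
        simp only [code, hd]
        split_ifs with h <;> simp [h]
    obtain ⟨n, w⟩ := AdviceSimulation.exists_within_majority x _ out d h₁ h₂
    exact ⟨d, n, by simp [hd], w.congr_left (congrArg (Turing.initList (AdviceSimulation.tm M))
      (List.map_id _).symm)⟩

/-! ### Countability of programs -/

section Countable
open Turing Turing.TM2 Turing.TM2.Stmt

variable {K : Type} {Γ : K → Type} {Λ σ : Type}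

/-- The height of the syntax tree of a statement. -/
def Turing.TM2.Stmt.height : Stmt Γ Λ σ → ℕ
  | push _ _ q => q.height + 1
  | peek _ _ q => q.height + 1
  | pop _ _ q => q.height + 1
  | load _ q => q.height + 1
  | branch _ q₁ q₂ => max q₁.height q₂.height + 1
  | goto _ => 0
  | halt => 0

/-- There are countably many statements over finite alphabets. -/
instance Turing.TM2.Stmt.instCountable [Finite K] [∀ k, Finite (Γ k)] [Finite Λ] [Finite σ] :
    Countable (Stmt Γ Λ σ) := by
  have key : ∀ n, {q : Stmt Γ Λ σ | q.height ≤ n}.Countable := by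
    intro n
    induction n with
    | zero =>
      refine (Set.countable_range fun f : Option (σ → Λ) => f.elim (halt : Stmt Γ Λ σ) goto).mono ?_
      intro q hq
      cases q with
      | goto f => exact ⟨some f, rfl⟩
      | halt => exact ⟨none, rfl⟩
      | _ => simp [height] at hq
    | succ n ih =>
      set Q := {q : Stmt Γ Λ σ | q.height ≤ n}
      have : Countable Q := ih.to_subtype
      have h₁ := Set.countable_range fun a : (Σ k, (σ → Γ k)) × Q => push a.1.1 a.1.2 a.2.1
      have h₂ := Set.countable_range fun a : (Σ k, (σ → Option (Γ k) → σ)) × Q =>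
        peek a.1.1 a.1.2 a.2.1
      have h₃ := Set.countable_range fun a : (Σ k, (σ → Option (Γ k) → σ)) × Q =>
        pop a.1.1 a.1.2 a.2.1
      have h₄ := Set.countable_range fun a : (σ → σ) × Q => load a.1 a.2.1
      have h₅ := Set.countable_range fun a : (σ → Bool) × Q × Q => branch a.1 a.2.1.1 a.2.2.1
      refine (ih.union (h₁.union (h₂.union (h₃.union (h₄.union h₅))))).mono fun q hq => ?_
      cases q with
      | push k f q => exact .inr (.inl ⟨⟨⟨k, f⟩, q, Nat.le_of_succ_le_succ hq⟩, rfl⟩)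
      | peek k f q => exact .inr (.inr (.inl ⟨⟨⟨k, f⟩, q, Nat.le_of_succ_le_succ hq⟩, rfl⟩))
      | pop k f q => exact .inr (.inr (.inr (.inl ⟨⟨⟨k, f⟩, q, Nat.le_of_succ_le_succ hq⟩, rfl⟩)))
      | load f q => exact .inr (.inr (.inr (.inr (.inl ⟨⟨f, q, Nat.le_of_succ_le_succ hq⟩, rfl⟩))))
      | branch f q₁ q₂ =>
        have hq : max q₁.height q₂.height ≤ n := Nat.le_of_succ_le_succ hq
        exact .inr (.inr (.inr (.inr (.inr
          ⟨⟨f, ⟨q₁, (le_max_left _ _).trans hq⟩, ⟨q₂, (le_max_right _ _).trans hq⟩⟩, rfl⟩))))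
      | goto f => exact .inl (Nat.zero_le _)
      | halt => exact .inl (Nat.zero_le _)
  rw [← Set.countable_univ_iff]
  refine (Set.countable_iUnion key).mono fun q _ => ?_
  exact Set.mem_iUnion.2 ⟨q.height, Nat.le_refl _⟩

end Countable

/-! ### Renaming machines into normal form -/

section Transfer
open Turing Turing.TM2 Turing.TM2.Stmt

variable {K K' : Type} {Γ : K → Type} {Γ' : K' → Type}
  {Λ Λ' σ σ' : Type} (eK : K ≃ K') (eΓ : ∀ k, Γ k ≃ Γ' (eK k)) (eΛ : Λ ≃ Λ') (eσ : σ ≃ σ')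

/-- A statement after renaming stacks, symbols, labels and states. -/
def Turing.TM2.Stmt.rename : Stmt Γ Λ σ → Stmt Γ' Λ' σ'
  | push k f q => push (eK k) (fun v => eΓ k (f (eσ.symm v))) q.rename
  | peek k f q => peek (eK k) (fun v a => eσ (f (eσ.symm v) (a.map (eΓ k).symm))) q.rename
  | pop k f q => pop (eK k) (fun v a => eσ (f (eσ.symm v) (a.map (eΓ k).symm))) q.rename
  | load f q => load (fun v => eσ (f (eσ.symm v))) q.rename
  | branch f q₁ q₂ => branch (fun v => f (eσ.symm v)) q₁.rename q₂.rename
  | goto f => goto fun v => eΛ (f (eσ.symm v))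
  | halt => halt

/-- The stacks after renaming. -/
def renameStk : (∀ k, List (Γ k)) ≃ ∀ k, List (Γ' k) :=
  eK.piCongr fun k => Equiv.listEquivOfEquiv (eΓ k)

theorem renameStk_apply (S : ∀ k, List (Γ k)) (k : K) :
    renameStk eK eΓ S (eK k) = (S k).map (eΓ k) :=
  Equiv.piCongr_apply_apply ..

theorem renameStk_update [DecidableEq K] [DecidableEq K'] (S : ∀ k, List (Γ k)) (k : K) (s : List (Γ k)) :
    renameStk eK eΓ (Function.update S k s) =
      Function.update (renameStk eK eΓ S) (eK k) (s.map (eΓ k)) := by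
  funext k'
  obtain ⟨j, rfl⟩ := eK.surjective k'
  rw [renameStk_apply]
  by_cases h : j = k
  · subst h; simp
  · rw [Function.update_of_ne h, Function.update_of_ne (eK.injective.ne h), renameStk_apply]

/-- A configuration after renaming. -/
def renameCfg (C : Cfg Γ Λ σ) : Cfg Γ' Λ' σ' :=
  ⟨C.l.map eΛ, eσ C.var, renameStk eK eΓ C.stk⟩

theorem renameCfg_injective : Function.Injective (renameCfg eK eΓ eΛ eσ) := by
  rintro ⟨l, v, S⟩ ⟨l', v', S'⟩ h
  simp only [renameCfg, Cfg.mk.injEq, EmbeddingLike.apply_eq_iff_eq] at h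
  obtain ⟨h₁, rfl, rfl⟩ := h
  rw [Option.map_injective eΛ.injective h₁]

theorem stepAux_rename [DecidableEq K] [DecidableEq K'] (q : Stmt Γ Λ σ) (v : σ) (S : ∀ k, List (Γ k)) :
    stepAux (q.rename eK eΓ eΛ eσ) (eσ v) (renameStk eK eΓ S) =
      renameCfg eK eΓ eΛ eσ (stepAux q v S) := by
  induction q generalizing v S with
  | push k f q ih =>
    rw [rename, stepAux, stepAux, ← ih, renameStk_update, renameStk_apply]
    simp
  | peek k f q ih =>
    rw [rename, stepAux, stepAux, ← ih, renameStk_apply]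
    simp [Function.comp_def]
  | pop k f q ih =>
    rw [rename, stepAux, stepAux, ← ih, renameStk_update, renameStk_apply]
    simp [Function.comp_def]
  | load f q ih => rw [rename, stepAux, stepAux, ← ih]; simp
  | branch f q₁ q₂ ih₁ ih₂ =>
    rw [rename, stepAux, stepAux, ih₁, ih₂, Equiv.symm_apply_apply]
    cases f v <;> rfl
  | goto f => simp [rename, renameCfg]
  | halt => simp [rename, renameCfg]

end Transfer

namespace ProbTM
open Turing

variable (M : ProbTM) {K' : Type} [DecidableEq K'] [Fintype K'] {Γ' : K' → Type}
  [∀ k, Fintype (Γ' k)] {Λ' σ' : Type} [Fintype Λ'] [Fintype σ'] (eK : M.K ≃ K')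
  (eΓ : ∀ k, M.Γ k ≃ Γ' (eK k)) (eΛ : M.Λ ≃ Λ') (eσ : M.σ ≃ σ')

/-- A probabilistic machine after renaming stacks, symbols, labels and states. -/
def rename : ProbTM where
  K := K'
  k₀ := eK M.k₀
  k₁ := eK M.k₁
  Γ := Γ'
  Λ := Λ'
  main := eΛ M.main
  σ := σ'
  initialState := eσ M.initialState
  m l := (M.m (eΛ.symm l)).rename eK eΓ eΛ eσ
  alphabetFinite _ := inferInstance
  m' l := (M.m' (eΛ.symm l)).rename eK eΓ eΛ eσ
  inputAlphabet := (eΓ M.k₀).symm.trans M.inputAlphabet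
  outputAlphabet := (eΓ M.k₁).symm.trans M.outputAlphabet

theorem step_rename (c : Bool) (C : M.Cfg) :
    (M.rename eK eΓ eΛ eσ).step c (renameCfg eK eΓ eΛ eσ C) =
      (M.step c C).map (renameCfg eK eΓ eΛ eσ) := by
  obtain ⟨_ | l, v, S⟩ := C
  · rfl
  · have h : (if c then (M.m' (eΛ.symm (eΛ l))).rename eK eΓ eΛ eσ else
        (M.m (eΛ.symm (eΛ l))).rename eK eΓ eΛ eσ) =
        (if c then M.m' l else M.m l).rename eK eΓ eΛ eσ := by
      rw [Equiv.symm_apply_apply]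
      cases c <;> rfl
    exact congrArg some ((congrArg (fun q => TM2.stepAux q (eσ v) (renameStk eK eΓ S)) h).trans
      (stepAux_rename eK eΓ eΛ eσ _ v S))

theorem run_rename (cs : List Bool) (C : M.Cfg) :
    (M.rename eK eΓ eΛ eσ).run cs (renameCfg eK eΓ eΛ eσ C) =
      renameCfg eK eΓ eΛ eσ (M.run cs C) := by
  induction cs generalizing C with
  | nil => rfl
  | cons c cs ih =>
    refine Eq.trans (congrArg ((M.rename eK eΓ eΛ eσ).run cs) ?_) (ih _)
    rw [step_rename]
    cases M.step c C <;> rfl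

/-- Renaming commutes with `run` and preserves initial and halting configurations; its injectivity
on configurations gives the forward direction. -/
theorem outputs_rename (s : List (Option Bool)) (cs : List Bool) (b : Bool) :
    (M.rename eK eΓ eΛ eσ).Outputs s cs b ↔ M.Outputs s cs b := by
  have hempty : renameStk eK eΓ (fun _ => []) = fun _ => [] := by
    funext k
    obtain ⟨k, rfl⟩ := eK.surjective k
    rw [renameStk_apply]; rfl
  have h₀ : initList (M.rename eK eΓ eΛ eσ).toFinTM2
      (s.map (M.rename eK eΓ eΛ eσ).inputAlphabet.symm) =
      renameCfg eK eΓ eΛ eσ (initList M.toFinTM2 (s.map M.inputAlphabet.symm)) := by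
    rw [FinTM2.initList_eq, FinTM2.initList_eq]
    refine congrArg (TM2.Cfg.mk _ _) ?_
    dsimp only
    rw [renameStk_update, hempty, List.map_map]
    rfl
  have h₁ : haltList (M.rename eK eΓ eΛ eσ).toFinTM2
      [(M.rename eK eΓ eΛ eσ).outputAlphabet.symm b] =
      renameCfg eK eΓ eΛ eσ (haltList M.toFinTM2 [M.outputAlphabet.symm b]) := by
    rw [FinTM2.haltList_eq, FinTM2.haltList_eq]
    refine congrArg (TM2.Cfg.mk _ _) ?_
    dsimp only
    rw [renameStk_update, hempty]
    rfl
  exact (Eq.congr ((congrArg ((M.rename eK eΓ eΛ eσ).run cs) h₀).trans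
    (M.run_rename eK eΓ eΛ eσ cs _)) h₁).trans (renameCfg_injective eK eΓ eΛ eσ).eq_iff

/-- `successProb` sees a machine only through `outputProb`, so diagonalizing against normal forms
suffices. -/
theorem outputProb_rename : (M.rename eK eΓ eΛ eσ).outputProb = M.outputProb := by
  funext t s b
  simp only [outputProb, outputs_rename]

/-- The data of a machine of given size. -/
abbrev NormalFormData (k : ℕ) (g : Fin k → ℕ) (l s : ℕ) (k₀ k₁ : Fin k) : Type :=
  (Fin l × Fin s) × ((Fin l → TM2.Stmt (fun i => Fin (g i)) (Fin l) (Fin s)) ×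
    (Fin l → TM2.Stmt (fun i => Fin (g i)) (Fin l) (Fin s))) ×
    (Fin (g k₀) ≃ Option Bool) × (Fin (g k₁) ≃ Bool)

/-- The machines whose stacks, symbols, labels and states are initial segments of `ℕ`. -/
abbrev NormalForm : Type :=
  Σ (k : ℕ) (g : Fin k → ℕ) (l s : ℕ) (k₀ k₁ : Fin k), NormalFormData k g l s k₀ k₁

theorem countable_normalFormData (k : ℕ) (g : Fin k → ℕ) (l s : ℕ) (k₀ k₁ : Fin k) :
    Countable (NormalFormData k g l s k₀ k₁) := by
  have h₁ : Countable (Fin l → TM2.Stmt (fun i => Fin (g i)) (Fin l) (Fin s)) := inferInstance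
  have h₂ : Countable (Fin (g k₀) ≃ Option Bool) := inferInstance
  have h₃ : Countable (Fin (g k₁) ≃ Bool) := inferInstance
  infer_instance

instance : Countable NormalForm := by
  have := countable_normalFormData
  infer_instance

/-- The machine with a given normal form. -/
def ofNormalForm : NormalForm → ProbTM
  | ⟨k, g, l, s, k₀, k₁, (main, init), (m, m'), ein, eout⟩ =>
    { K := Fin k, k₀ := k₀, k₁ := k₁, Γ := fun i => Fin (g i), Λ := Fin l, main := main,
      σ := Fin s, initialState := init, m := m, alphabetFinite := fun _ => inferInstance, m' := m',
      inputAlphabet := ein, outputAlphabet := eout }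

/-- Every machine behaves like one in normal form. -/
theorem exists_normalForm (M : ProbTM) :
    ∃ N : NormalForm, (ofNormalForm N).outputProb = M.outputProb := by
  have := M.kFin
  have := M.ΛFin
  have := M.σFin
  have := fun k => @Fintype.ofFinite _ (M.alphabetFinite k)
  let eK := Fintype.equivFin M.K
  let g (i : Fin (Fintype.card M.K)) : ℕ := Fintype.card (M.Γ (eK.symm i))
  have eΓ (k : M.K) : M.Γ k ≃ Fin (g (eK k)) :=
    Fintype.equivFinOfCardEq (by simp only [g, Equiv.symm_apply_apply])
  let eΛ := Fintype.equivFin M.Λ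
  let eσ := Fintype.equivFin M.σ
  refine ⟨⟨_, g, _, _, eK M.k₀, eK M.k₁, (eΛ M.main, eσ M.initialState),
    (fun l => (M.m (eΛ.symm l)).rename eK eΓ eΛ eσ,
      fun l => (M.m' (eΛ.symm l)).rename eK eΓ eΛ eσ),
    (eΓ M.k₀).symm.trans M.inputAlphabet, (eΓ M.k₁).symm.trans M.outputAlphabet⟩, ?_⟩
  exact M.outputProb_rename (Γ' := fun i => Fin (g i)) eK eΓ eΛ eσ

end ProbTM

/-! ### A language in P/poly outside BPP/samp(D) -/

theorem ProbTM.outputProb_add_le (M : ProbTM) (t : ℕ) (s : List (Option Bool)) :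
    M.outputProb t s false + M.outputProb t s true ≤ 1 := by
  classical
  rw [outputProb_eq_sum, outputProb_eq_sum, ← Finset.sum_add_distrib]
  calc _ ≤ ∑ _cs : Fin t → Bool, ((2 : ℝ≥0∞) ^ t)⁻¹ := by
        refine Finset.sum_le_sum fun cs _ => ?_
        split_ifs with h₁ h₂
        · exact absurd (h₁.unique h₂) (by simp)
        all_goals simp
    _ = 1 := by simp [ENNReal.mul_inv_cancel]

theorem ProbTM.outputProb_le_one (M : ProbTM) (t : ℕ) (s : List (Option Bool)) (b : Bool) :
    M.outputProb t s b ≤ 1 := by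
  have h := M.outputProb_add_le t s
  cases b
  exacts [le_self_add.trans h, le_add_self.trans h]

/-- A point occurs among `p` independent samples with probability at most `p` times its mass. -/
theorem PMF.sum_prod_mem_le {n : ℕ} (p : ℕ) (μ : PMF (Fin n → Bool)) (z : Fin n → Bool) :
    ∑ y : Fin p → (Fin n → Bool), (∏ i, μ (y i)) * (if ∃ i, y i = z then 1 else 0) ≤ p * μ z := by
  classical
  have hμ : ∑ a, μ a = 1 := by rw [← tsum_fintype (L := .unconditional _), μ.tsum_coe]
  -- The `i`-th sample has law `μ`: the sum factors over the coordinates, and the other factors are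
  -- `1`. A union bound over `i` follows.
  have key : ∀ i : Fin p, ∑ y : Fin p → (Fin n → Bool),
      (∏ j, μ (y j)) * (if y i = z then 1 else 0) = μ z := by
    intro i
    have h₁ : ∀ y : Fin p → (Fin n → Bool), (∏ j, μ (y j)) * (if y i = z then 1 else 0) =
        ∏ j, μ (y j) * (if j = i then if y j = z then 1 else 0 else 1) := by
      intro y
      rw [Finset.prod_mul_distrib, Finset.prod_ite_eq' Finset.univ i
        (fun j => if y j = z then (1 : ℝ≥0∞) else 0)]
      simp
    have h₂ := Finset.prod_univ_sum (fun _ : Fin p => (Finset.univ : Finset (Fin n → Bool)))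
      (fun j a => μ a * (if j = i then if a = z then 1 else 0 else 1))
    rw [Fintype.piFinset_univ] at h₂
    rw [Finset.sum_congr rfl fun y _ => h₁ y, ← h₂, Finset.prod_eq_single i]
    · simp
    · intro j _ hj
      simp [hj, hμ]
    · simp
  calc _ ≤ ∑ y : Fin p → (Fin n → Bool), ∑ i,
        (∏ j, μ (y j)) * (if y i = z then 1 else 0) := by
        refine Finset.sum_le_sum fun y _ => ?_
        rw [← Finset.mul_sum]
        gcongr
        split_ifs with h
        · obtain ⟨i, hi⟩ := h
          refine le_trans (by simp [hi]) (Finset.single_le_sum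
            (f := fun i => if y i = z then (1 : ℝ≥0∞) else 0) (fun _ _ => zero_le)
            (Finset.mem_univ i))
        · exact zero_le
    _ = p * μ z := by
        rw [Finset.sum_comm, Finset.sum_congr rfl fun i _ => key i]
        simp

theorem trainingSet_congr {L L' : Language Bool} {n p : ℕ} {y : Fin p → (Fin n → Bool)}
    (h : ∀ i, List.ofFn (y i) ∈ L ↔ List.ofFn (y i) ∈ L') : trainingSet L y = trainingSet L' y := by
  unfold trainingSet
  congr 1
  funext i
  rw [decide_eq_decide.2 (h i)]

theorem successProb_congr {L L' : Language Bool} (M : ProbTM) (t : ℕ → ℕ) {n : ℕ}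
    (μ : PMF (Fin n → Bool)) (p : ℕ) {x : List Bool}
    (h : ∀ v : Fin n → Bool, List.ofFn v ∈ L ↔ List.ofFn v ∈ L') (hx : x ∈ L ↔ x ∈ L') :
    successProb M t μ p L x = successProb M t μ p L' x := by
  refine Finset.sum_congr rfl fun y _ => ?_
  rw [trainingSet_congr fun i => h (y i), decide_eq_decide.2 hx]

/-- A machine that errs with probability at most `1 / 3` on a word not in the language errs often if
this word, of small probability, is added. -/
theorem successProb_lt_of_insert {M : ProbTM} {t : ℕ → ℕ} {n : ℕ} {μ : PMF (Fin n → Bool)} {p : ℕ}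
    {L L' : Language Bool} {z : Fin n → Bool} (hz : p * μ z < 1 / 3)
    (hL : ∀ v, v ≠ z → (List.ofFn v ∈ L ↔ List.ofFn v ∈ L')) (hzL : List.ofFn z ∉ L)
    (hzL' : List.ofFn z ∈ L') (h : 2 / 3 ≤ successProb M t μ p L (List.ofFn z)) :
    successProb M t μ p L' (List.ofFn z) < 2 / 3 := by
  classical
  let out (b : Bool) (y : Fin p → (Fin n → Bool)) : ℝ≥0∞ :=
    M.outputProb (t (encodeTraining (List.ofFn z) (trainingSet L y)).length)
      (encodeTraining (List.ofFn z) (trainingSet L y)) b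
  let w (y : Fin p → (Fin n → Bool)) : ℝ≥0∞ := ∏ i, μ (y i)
  have h₁ : ∑ y, w y * out false y + ∑ y, w y * out true y ≤ 1 := by
    rw [← Finset.sum_add_distrib, ← PMF.sum_prod_eq_one (p := p) μ]
    refine Finset.sum_le_sum fun y _ => ?_
    rw [← mul_add]
    exact (mul_le_mul_right (M.outputProb_add_le _ _) _).trans (mul_one _).le
  have h₂ : 2 / 3 ≤ ∑ y, w y * out false y := by
    simpa only [successProb, hzL, decide_false] using h
  have h₃ : ∑ y, w y * out true y ≤ 1 / 3 := by
    have : (2 / 3 : ℝ≥0∞) + ∑ y, w y * out true y ≤ 2 / 3 + 1 / 3 := by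
      refine (add_le_add_left h₂ _).trans (h₁.trans (le_of_eq ?_))
      rw [ENNReal.div_add_div_same, show (2 + 1 : ℝ≥0∞) = 3 by norm_num]
      exact (ENNReal.div_self (by norm_num) (by norm_num)).symm
    exact (ENNReal.add_le_add_iff_left (ENNReal.div_ne_top (by norm_num) (by norm_num))).1 this
  -- Unless `z` is sampled, the training sets for `L` and `L'` coincide, and there `true` has total
  -- probability at most `1/3`. Sampling `z` adds at most `p * μ z`.
  calc successProb M t μ p L' (List.ofFn z)
      ≤ ∑ y, (w y * out true y + w y * (if ∃ i, y i = z then 1 else 0)) := by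
        refine Finset.sum_le_sum fun y _ => ?_
        rw [← mul_add]
        refine mul_le_mul_right ?_ _
        by_cases hy : ∃ i, y i = z
        · rw [if_pos hy]
          exact (M.outputProb_le_one _ _ _).trans le_add_self
        · rw [if_neg hy, add_zero, ← trainingSet_congr fun i => hL _ fun hi => hy ⟨i, hi⟩]
          simp only [hzL', decide_true, out, le_refl]
    _ ≤ 1 / 3 + p * μ z := by
        rw [Finset.sum_add_distrib]
        exact add_le_add h₃ (PMF.sum_prod_mem_le p μ z)
    _ < 1 / 3 + 1 / 3 := ENNReal.add_lt_add_left (ENNReal.div_ne_top (by norm_num) (by norm_num)) hz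
    _ = 2 / 3 := by rw [ENNReal.div_add_div_same]; norm_num

theorem PMF.exists_le_inv_two_pow {n : ℕ} (μ : PMF (Fin n → Bool)) :
    ∃ z, μ z ≤ ((2 : ℝ≥0∞) ^ n)⁻¹ := by
  have hμ : ∑ a, μ a = 1 := by rw [← tsum_fintype (L := .unconditional _), μ.tsum_coe]
  by_contra! h
  have := ENNReal.sum_lt_sum_of_nonempty (s := (Finset.univ : Finset (Fin n → Bool)))
    Finset.univ_nonempty fun z _ => h z
  rw [hμ] at this
  simp [ENNReal.mul_inv_cancel] at this

/-- The constant `c` makes the induction work: for a sum, both summands are used with `2 * c`. -/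
theorem Polynomial.eventually_mul_eval_lt_two_pow (p : Polynomial ℕ) (c : ℕ) :
    ∀ᶠ n in Filter.atTop, c * p.eval n < 2 ^ n := by
  induction p using Polynomial.induction_on' generalizing c with
  | add p q hp hq =>
    filter_upwards [hp (2 * c), hq (2 * c)] with n h₁ h₂
    rw [Polynomial.eval_add]
    nlinarith
  | monomial k a =>
    have h := (tendsto_pow_const_div_const_pow_of_one_lt k (one_lt_two (α := ℝ))).const_mul
      ((c * a : ℕ) : ℝ)
    rw [mul_zero] at h
    filter_upwards [h.eventually_lt_const one_pos] with n hn
    rw [← mul_div_assoc, div_lt_one (by positivity)] at hn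
    rw [Polynomial.eval_monomial, ← mul_assoc]
    exact_mod_cast hn

instance Polynomial.countable_nat : Countable (Polynomial ℕ) := by
  rw [← Cardinal.mk_le_aleph0_iff]
  simp

/-- A language with at most one word of each length that is not in `BPP/samp(D)`: at length `n` it
diagonalizes against the machine and the polynomials with number `(Nat.unpair n).1`. -/
theorem exists_mem_PPoly_notMem_BPPSamp (D : (n : ℕ) → PMF (Fin n → Bool)) :
    ∃ L ∈ PPoly, L ∉ BPPSamp D := by
  choose z hz using fun n => (D n).exists_le_inv_two_pow
  obtain ⟨e, he⟩ := @exists_surjective_nat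
    (Option (ProbTM.NormalForm × Polynomial ℕ × Polynomial ℕ)) ⟨none⟩ inferInstance
  -- `0` is the empty language: `z n` goes into `L` exactly when the assigned machine meets the
  -- success bound at `z n` for the empty language.
  let c (n : ℕ) : Prop := ∃ N t p, e (Nat.unpair n).1 = some (N, t, p) ∧
    2 / 3 ≤ successProb (ProbTM.ofNormalForm N) (fun n => t.eval n) (D n) (p.eval n) 0
      (List.ofFn (z n))
  let L : Language Bool := {x | c x.length ∧ x = List.ofFn (z x.length)}
  have hL : ∀ (n : ℕ) (v : Fin n → Bool), List.ofFn v ∈ L ↔ c n ∧ v = z n := by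
    intro n v
    have key : ∀ m, m = n → (c m ∧ List.ofFn v = List.ofFn (z m) ↔ c n ∧ v = z n) := by
      rintro _ rfl
      rw [List.ofFn_inj]
    exact key _ List.length_ofFn
  refine ⟨L, mem_PPoly_of_subsingleton L (fun n => List.ofFn (z n)) (by simp) c fun _ => Iff.rfl, ?_⟩
  rintro ⟨M, t, p, -, h⟩
  obtain ⟨N, hN⟩ := M.exists_normalForm
  obtain ⟨i, hi⟩ := he (some (N, t, p))
  obtain ⟨n₀, hn₀⟩ := Filter.eventually_atTop.1 (p.eventually_mul_eval_lt_two_pow 3)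
  -- The first component selects the machine; the second makes `n ≥ n₀`, so that `3 * p.eval n < 2 ^
  -- n`.
  set n := Nat.pair i n₀
  have hn := hn₀ n (Nat.right_le_pair _ _)
  -- The distributions at the two lengths have different types, so the equality is generalized and
  -- substituted.
  have hx : ∀ m, m = n → 2 / 3 ≤ successProb M (fun n => t.eval n) (D m) (p.eval m) L
      (List.ofFn (z n)) → 2 / 3 ≤ successProb M (fun n => t.eval n) (D n) (p.eval n) L
      (List.ofFn (z n)) := by
    rintro _ rfl h
    exact h
  have hs := hx _ List.length_ofFn (h (List.ofFn (z n)))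
  have hc : c n ↔ 2 / 3 ≤ successProb M (fun n => t.eval n) (D n) (p.eval n) 0
      (List.ofFn (z n)) := by
    simp only [c, n, Nat.unpair_pair, hi, Option.some.injEq, Prod.mk.injEq]
    simp only [successProb, ← hN]
    constructor
    · rintro ⟨_, _, _, ⟨rfl, rfl, rfl⟩, h⟩
      exact h
    · exact fun h => ⟨_, _, _, ⟨rfl, rfl, rfl⟩, h⟩
  -- If `z n` was added, the machine cannot notice and fails on it. Otherwise `L` is empty at length
  -- `n`, and success on `z n` would have forced `c n`.
  by_cases hcn : c n
  · refine (successProb_lt_of_insert ?_ (fun v hv => ?_) (Language.notMem_zero _)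
      ((hL n (z n)).2 ⟨hcn, rfl⟩) (hc.1 hcn)).not_ge hs
    · calc ((p.eval n : ℕ) : ℝ≥0∞) * D n (z n) ≤ (p.eval n : ℕ) * ((2 : ℝ≥0∞) ^ n)⁻¹ := by gcongr; exact hz n
        _ < 1 / 3 := by
          rw [← div_eq_mul_inv, ENNReal.div_lt_iff (by simp) (by simp), mul_comm, mul_one_div,
            ENNReal.lt_div_iff_mul_lt (by simp) (by simp), mul_comm]
          exact_mod_cast hn
    · rw [hL]
      exact iff_of_false (Language.notMem_zero _) fun h => hv h.2
  · refine hcn (hc.2 ?_)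
    rwa [successProb_congr (L' := 0)] at hs
    · intro v
      rw [hL]
      exact iff_of_false (fun h => hcn h.1) (Language.notMem_zero _)
    · rw [hL]
      exact iff_of_false (fun h => hcn h.1) (Language.notMem_zero _)

theorem theorem2 (D : (n : ℕ) → PMF (Fin n → Bool)) : BPPSamp D ⊂ PPoly := by
  obtain ⟨L, hL, hLD⟩ := exists_mem_PPoly_notMem_BPPSamp D
  exact ⟨BPPSamp_subset_PPoly D, fun h => hLD (h hL)⟩
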